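/- Let $K$ be a field of characteristic $0$, let $e_4,e_6\in K$ be such that $4x^3-60e_4x-140e_6$ has nonzero discriminant, let $X=E\setminus\{\infty\}$ be the once-punctured elliptic curve $y^2=4x^3-60e_4x-140e_6$ over $K$, and let $b\in X(K)$. Put $\alpha=dx/y$ and $\beta=x\,dx/y$ (regular $1$-forms on $X$). Let $e_2=0$, $e_n=0$ for $n$ odd, and for $m\ge 4$ define $e_{2m}$ by $$\tfrac13(m-3)(4m^2-1)e_{2m}=\sum_{r=2}^{m-2}(2r-1)(2m-2r-1)e_{2r}e_{2m-2r}.$$ Let $\partial$ be the derivation of $\mathcal O_X$ dual to $\alpha$ (so $\partial x=y$, $\partial y=6x^2-30e_4$), and for $k\ge 2$ let $P_k=\frac{(-1)^k}{(k-1)!}\partial^{k-2}x-e_k$. For a series $\omega=\sum_w \omega_w w$ in words $w$ in $A,B$, with $\omega_w\in\Omega^1_X$, of zero constant term, $d+\omega$ denotes the connection $s\mapsto ds+\omega s$ (left multiplication) on $\mathcal O_X\langle\langle A,B\rangle\rangle$, regarded as the inverse limit of the connections $(d+\omega)_n$ that it induces on the quotients $\mathcal O_X\langle\langle A,B\rangle\rangle/(A,B)^{n+1}$.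 A morphism from it to a connection $V$ on $X$ of finite rank is one that factors through $(d+\omega)_n$ for some $n$, and a morphism between two such limits is an $\mathcal O_X$-linear map whose composite with each projection to a quotient is a morphism. A connection is unipotent if it is a successive extension of trivial connections $(\mathcal O_X,d)$. Such a limit, with marked element $1$ in its fibre $K\langle\langle A,B\rangle\rangle$ over $b$, represents the universal pointed unipotent connection on $X$ if each $(d+\omega)_n$ is unipotent and, for every unipotent connection $V$ on $X$ and every $v\in V_b$, there is a unique morphism $\phi:\mathcal O_X\langle\langle A,B\rangle\rangle\to V$ of connections with $\phi_b(1)=v$. (1) The algebraic KZB connection $\nabla_{KZB}=d-\omega_{KZB}$ on $\mathcal O_X\langle\langle A,B\rangle\rangle$, where $$\omega_{KZB}=\beta B+\alpha\exp\Bigl(-\sum_{k\ge 2}\frac{(-1)^kP_k\,\mathrm{ad}_B^k}{k}\Bigr)A,$$ with marked element $1$ over $b$, represents the universal pointed unipotent connection on $X$. (2) Let $\omega=\alpha A+\beta B+\sum_{|w|>1}r_w w$ with arbitrary $r_w\in\Omega^1_X$, the sum being over the words of length greater than one. Then each of the connections $d+\omega$ and $d-\omega$ on $\mathcal O_X\langle\langle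 A,B\rangle\rangle$, with marked element $1$ over $b$, is isomorphic, as a pointed connection, to the naive connection $\nabla_0=d-\alpha A-\beta B$ with marked element $1$ over $b$; that is, there is an $\mathcal O_X$-linear automorphism $g$ of $\mathcal O_X\langle\langle A,B\rangle\rangle$ such that $g$ and $g^{-1}$ are morphisms of connections and $g(1)(b)=1$. -/

import Mathlib

open scoped TensorProduct

universe u

noncomputable section

namespace KZB

/-! ### Connections on an affine scheme `Spec R` over `K`

Vector bundles on `Spec R` are `R`-modules.  For a curve there are no nonzero two-forms, so every
connection is flat. -/

section Connections

variable (K R : Type u) [CommRing K] [CommRing R] [Algebra K R]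

/-- A connection `∇ : M → Ω¹ ⊗ M` on an `R`-module.  (`K`-linearity follows from additivity and the
Leibniz rule, as `d` kills the constants.) -/
structure Connection (M : Type u) [AddCommGroup M] [Module R M] where
  toFun : M →+ Ω[R⁄K] ⊗[R] M
  leibniz : ∀ (r : R) (m : M),
    toFun (r • m) = KaehlerDifferential.D K R r ⊗ₜ[R] m + r • toFun m

/-- The trivial connection `(O, d)`. -/
def trivialConnection : Connection K R R where
  toFun := ((TensorProduct.rid R (Ω[R⁄K])).symm : Ω[R⁄K] →+ Ω[R⁄K] ⊗[R] R).comp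
    (KaehlerDifferential.D K R : R →ₗ[K] Ω[R⁄K]).toAddMonoidHom
  leibniz r m := by
    simp only [AddMonoidHom.comp_apply, LinearMap.toAddMonoidHom_coe, Derivation.coeFn_coe,
      smul_eq_mul, Derivation.leibniz, map_add]
    simp [TensorProduct.rid_symm_apply, TensorProduct.smul_tmul, add_comm,
      TensorProduct.smul_tmul']

variable {K R}

/-- A morphism of connections: an `R`-linear map `φ` with `∇' ∘ φ = (id ⊗ φ) ∘ ∇`. -/
def IsHorizontal {M N : Type u} [AddCommGroup M] [Module R M] [AddCommGroup N] [Module R N]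
    (nabla : Connection K R M) (nabla' : Connection K R N) (φ : M →ₗ[R] N) : Prop :=
  ∀ m, nabla'.toFun (φ m) = φ.lTensor (Ω[R⁄K]) (nabla.toFun m)

/-- Unipotent connections: those obtained from `0` by successive extensions
`0 → M' → M → O → 0` by the trivial connection.  (The underlying modules are automatically free
of finite rank.) -/
inductive IsUnipotent : ∀ (M : Type u) [AddCommGroup M] [Module R M], Connection K R M → Prop
  | zero (M : Type u) [AddCommGroup M] [Module R M] [Subsingleton M] (nabla : Connection K R M) :
      IsUnipotent M nabla
  | extension (M' M : Type u) [AddCommGroup M'] [Module R M'] [AddCommGroup M] [Module R M]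
      (nabla' : Connection K R M') (nabla : Connection K R M)
      (i : M' →ₗ[R] M) (p : M →ₗ[R] R)
      (hi : Function.Injective i) (hex : Function.Exact i p) (hp : Function.Surjective p)
      (hori : IsHorizontal nabla' nabla i) (horp : IsHorizontal nabla (trivialConnection K R) p)
      (h : IsUnipotent M' nabla') : IsUnipotent M nabla

/-- The fibre `M_b = M / 𝔪_b M` of `M` over the `K`-rational point `b`, where `𝔪_b = ker b`. -/
abbrev Fibre (b : R →ₐ[K] K) (M : Type u) [AddCommGroup M] [Module R M] : Type u :=
  M ⧸ (RingHom.ker b • (⊤ : Submodule R M))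

/-- The value `m(b) ∈ M_b` of a section `m`. -/
def evalFibre (b : R →ₐ[K] K) (M : Type u) [AddCommGroup M] [Module R M] (m : M) : Fibre b M :=
  Submodule.Quotient.mk m

end Connections

/-! ### Connections on `O⟨⟨A,B⟩⟩` -/

/-- Words in the letters `A = 0` and `B = 1`. -/
abbrev Word : Type := List (Fin 2)

/-- Words of length at most `n`. -/
abbrev WordLE (n : ℕ) : Type := {w : Word // w.length ≤ n}

instance (n : ℕ) : Fintype (WordLE n) := (List.finite_length_le (Fin 2) n).fintype

/-- Noncommutative formal power series in `A`, `B` with coefficients in `S`; the value at `w` is the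
coefficient of the word `w`.  Thus `Series R` is `O⟨⟨A,B⟩⟩`, and `Series Ω[R⁄K]` is `Ω¹⟨⟨A,B⟩⟩`. -/
abbrev Series (S : Type u) : Type u := Word → S

section FormalConnections

variable {K R : Type u} [CommRing K] [CommRing R] [Algebra K R]

/-- The series `1`. -/
def one (S : Type u) [Zero S] [One S] : Series S := Pi.single [] 1

/-- The operator `∇ = d + ω` on `O⟨⟨A,B⟩⟩`, where `ω = ∑ ω_w w` acts by left multiplication. -/
def formalConnection (ω : Series (Ω[R⁄K])) (s : Series R) : Series (Ω[R⁄K]) := fun v =>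
  KaehlerDifferential.D K R (s v)
    + ∑ i ∈ Finset.range (v.length + 1), s (v.drop i) • ω (v.take i)

/-- Truncation `O⟨⟨A,B⟩⟩ → O⟨⟨A,B⟩⟩ / I^{n+1}`, where `I = (A, B)`; the target is the free module on
the words of length at most `n`. -/
def trunc (R : Type u) [CommRing R] (n : ℕ) : Series R →ₗ[R] (WordLE n → R) :=
  LinearMap.funLeft R R Subtype.val

/-- The connection `(d + ω)_n` induced by `d + ω` on `O⟨⟨A,B⟩⟩ / I^{n+1}`. -/
def truncConnection (ω : Series (Ω[R⁄K])) (n : ℕ) : Connection K R (WordLE n → R) where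
  toFun :=
    { toFun := fun s => ∑ v : WordLE n,
        (KaehlerDifferential.D K R (s v) + ∑ i ∈ Finset.range (v.1.length + 1),
          s ⟨v.1.drop i, (by simpa using Nat.le_add_right_of_le v.2)⟩ • ω (v.1.take i))
            ⊗ₜ[R] (Pi.single v 1 : WordLE n → R)
      map_zero' := by simp
      map_add' := fun s t => by
        rw [← Finset.sum_add_distrib]
        refine Finset.sum_congr rfl fun v _ => ?_
        rw [← TensorProduct.add_tmul]
        congr 1
        simp only [Pi.add_apply, map_add, add_smul, Finset.sum_add_distrib]
        abel }
  leibniz r s := by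
    have hs : s = ∑ v : WordLE n, s v • (Pi.single v 1 : WordLE n → R) := by
      ext w
      simp [Finset.sum_apply, Pi.single_apply]
    change (∑ v : WordLE n, _) = _ + r • ∑ v : WordLE n, _
    conv_rhs => rw [hs, TensorProduct.tmul_sum]
    rw [Finset.smul_sum, ← Finset.sum_add_distrib]
    refine Finset.sum_congr rfl fun v _ => ?_
    rw [TensorProduct.tmul_smul, TensorProduct.smul_tmul', TensorProduct.smul_tmul',
      ← TensorProduct.add_tmul]
    congr 1
    simp only [Pi.smul_apply, smul_eq_mul, Derivation.leibniz, smul_add, Finset.smul_sum, smul_smul]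
    rw [← hs]
    abel

/-- `(d + ω)_n` is the reduction of `d + ω`. -/
theorem truncConnection_trunc (ω : Series (Ω[R⁄K])) (n : ℕ) (s : Series R) :
    (truncConnection ω n).toFun (trunc R n s)
      = ∑ v : WordLE n, formalConnection ω s v ⊗ₜ[R] (Pi.single v 1 : WordLE n → R) := rfl

/-- Morphisms from the pro-object `(O⟨⟨A,B⟩⟩, d + ω) = lim_n (d + ω)_n` to a connection `V`: linear
maps that factor through a morphism of connections `O⟨⟨A,B⟩⟩ / I^{n+1} → V` for some `n`. -/
def IsMorphism (ω : Series (Ω[R⁄K])) {V : Type u} [AddCommGroup V] [Module R V]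
    (nabla : Connection K R V) (φ : Series R →ₗ[R] V) : Prop :=
  ∃ (n : ℕ) (ψ : (WordLE n → R) →ₗ[R] V),
    IsHorizontal (truncConnection ω n) nabla ψ ∧ φ = ψ ∘ₗ trunc R n

/-- `(O⟨⟨A,B⟩⟩, d + ω)`, with marked element `1` in the fibre over `b`, represents the universal
pointed unipotent connection: it is pro-unipotent, and for every unipotent connection `V` and every
`v ∈ V_b` there is a unique morphism `φ : O⟨⟨A,B⟩⟩ → V` of connections with `φ_b(1) = v`. -/
def RepresentsUniversal (b : R →ₐ[K] K) (ω : Series (Ω[R⁄K])) : Prop :=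
  (∀ n, IsUnipotent (WordLE n → R) (truncConnection ω n)) ∧
  ∀ (V : Type u) [AddCommGroup V] [Module R V] (nabla : Connection K R V),
    IsUnipotent V nabla → ∀ v : Fibre b V,
      ∃! φ : Series R →ₗ[R] V, IsMorphism ω nabla φ ∧ evalFibre b V (φ (one R)) = v

/-- `(O⟨⟨A,B⟩⟩, d + ω)` and `(O⟨⟨A,B⟩⟩, d + ω')`, both with marked element `1` in the fibre
`K⟨⟨A,B⟩⟩` over `b`, are isomorphic as pointed (pro-)connections. -/
def PointedIsomorphic (b : R →ₐ[K] K) (ω ω' : Series (Ω[R⁄K])) : Prop :=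
  ∃ g : Series R ≃ₗ[R] Series R,
    (∀ n, IsMorphism ω (truncConnection ω' n) (trunc R n ∘ₗ g.toLinearMap)) ∧
    (∀ n, IsMorphism ω' (truncConnection ω n) (trunc R n ∘ₗ g.symm.toLinearMap)) ∧
    (fun w => b (g (one R) w)) = one K

end FormalConnections

/-! ### The once-punctured elliptic curve `X : y² = 4x³ - 60 e₄ x - 140 e₆` -/

section EllipticCurve

open Polynomial in
/-- The cubic polynomial `4x³ - 60 e₄ x - 140 e₆`. -/
def cubic {K : Type u} [Field K] (e₄ e₆ : K) : K[X] :=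
  4 * X ^ 3 - C (60 * e₄) * X - C (140 * e₆)

open Polynomial in
/-- The coordinate ring `O_X = K[x,y] / (y² - (4x³ - 60 e₄ x - 140 e₆))`. -/
abbrev CoordRing {K : Type u} [Field K] (e₄ e₆ : K) : Type u :=
  AdjoinRoot ((X : K[X][X]) ^ 2 - C (cubic e₄ e₆))

variable {K : Type u} [Field K] (e₄ e₆ : K)

/-- The discriminant `g₂³ - 27 g₃²` of `4x³ - g₂ x - g₃` (up to a factor 16), with `g₂ = 60 e₄` and
`g₃ = 140 e₆`. -/
def disc : K := (60 * e₄) ^ 3 - 27 * (140 * e₆) ^ 2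

/-- The function `x`. -/
def x : CoordRing e₄ e₆ := AdjoinRoot.of _ Polynomial.X

/-- The function `y`. -/
def y : CoordRing e₄ e₆ := AdjoinRoot.root _

theorem y_sq : y e₄ e₆ ^ 2 = 4 * x e₄ e₆ ^ 3 - algebraMap K _ (60 * e₄) * x e₄ e₆
    - algebraMap K _ (140 * e₆) := by
  have h := AdjoinRoot.mk_self
    (f := (Polynomial.X : Polynomial (Polynomial K)) ^ 2 - Polynomial.C (cubic e₄ e₆))
  rw [map_sub, map_pow, AdjoinRoot.mk_X, AdjoinRoot.mk_C, sub_eq_zero] at h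
  have hc : ∀ φ : Polynomial K →+* CoordRing e₄ e₆, φ (cubic e₄ e₆) = 4 * φ Polynomial.X ^ 3
      - φ (Polynomial.C (60 * e₄)) * φ Polynomial.X - φ (Polynomial.C (140 * e₆)) := by
    intro φ
    change φ (4 * Polynomial.X ^ 3 - Polynomial.C (60 * e₄) * Polynomial.X
      - Polynomial.C (140 * e₆)) = _
    rw [map_sub, map_sub, map_mul, map_mul, map_pow, map_ofNat]
  rw [y, h, hc]
  rfl

/-- The invariant differential `α = dx / y`, written without denominators: with `p = 4x³ - g₂x - g₃`
one has `u p + v p' = 1` for `u = -(18 g₂ x - 27 g₃) / Δ`, `v = (6 g₂ x² - 9 g₃ x - g₂²) / Δ`, where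
`Δ = g₂³ - 27 g₃²`, and `α = u y dx + 2 v dy`.  See `y_smul_alpha`. -/
def alpha : Ω[CoordRing e₄ e₆⁄K] :=
  (-(algebraMap K _ ((disc e₄ e₆)⁻¹)) *
      (18 * algebraMap K _ (60 * e₄) * x e₄ e₆ - 27 * algebraMap K _ (140 * e₆)) * y e₄ e₆) •
    KaehlerDifferential.D K (CoordRing e₄ e₆) (x e₄ e₆)
  + (2 * algebraMap K _ ((disc e₄ e₆)⁻¹) *
      (6 * algebraMap K _ (60 * e₄) * x e₄ e₆ ^ 2 - 9 * algebraMap K _ (140 * e₆) * x e₄ e₆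
        - algebraMap K _ (60 * e₄) ^ 2)) •
    KaehlerDifferential.D K (CoordRing e₄ e₆) (y e₄ e₆)

/-- The defining property of `α = dx / y`. -/
theorem y_smul_alpha (h : disc e₄ e₆ ≠ 0) :
    y e₄ e₆ • alpha e₄ e₆ = KaehlerDifferential.D K (CoordRing e₄ e₆) (x e₄ e₆) := by
  have hy := y_sq e₄ e₆
  set X := x e₄ e₆
  set Y := y e₄ e₆
  set g2 : CoordRing e₄ e₆ := algebraMap K _ (60 * e₄) with hg2
  set g3 : CoordRing e₄ e₆ := algebraMap K _ (140 * e₆) with hg3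
  set δ : CoordRing e₄ e₆ := algebraMap K _ (disc e₄ e₆)⁻¹ with hδ
  have hδ1 : δ * (g2 ^ 3 - 27 * g3 ^ 2) = 1 := by
    have h27 : (27 : CoordRing e₄ e₆) = algebraMap K _ 27 := (map_ofNat _ 27).symm
    rw [hg2, hg3, hδ, h27, ← map_pow, ← map_pow, ← map_mul, ← map_sub, ← map_mul]
    change algebraMap K _ ((disc e₄ e₆)⁻¹ * disc e₄ e₆) = 1
    rw [inv_mul_cancel₀ h, map_one]
  have hd : (2 * Y) • KaehlerDifferential.D K (CoordRing e₄ e₆) Y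
      = (12 * X ^ 2 - g2) • KaehlerDifferential.D K (CoordRing e₄ e₆) X := by
    have h1 := congrArg (KaehlerDifferential.D K (CoordRing e₄ e₆)) hy
    have d2 : KaehlerDifferential.D K (CoordRing e₄ e₆) g2 = 0 := Derivation.map_algebraMap _ _
    have d3 : KaehlerDifferential.D K (CoordRing e₄ e₆) g3 = 0 := Derivation.map_algebraMap _ _
    have d4 : KaehlerDifferential.D K (CoordRing e₄ e₆) 4 = 0 := by
      rw [← map_ofNat (algebraMap K (CoordRing e₄ e₆)) 4]
      exact Derivation.map_algebraMap _ _
    rw [map_sub, map_sub, Derivation.leibniz_pow, Derivation.leibniz, Derivation.leibniz,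
      Derivation.leibniz_pow, d2, d3, d4] at h1
    rw [← sub_eq_zero] at h1 ⊢
    rw [← h1]
    module
  have key : Y • alpha e₄ e₆ = (-δ * (18 * g2 * X - 27 * g3) * Y ^ 2) •
        KaehlerDifferential.D K (CoordRing e₄ e₆) X
      + (δ * (6 * g2 * X ^ 2 - 9 * g3 * X - g2 ^ 2)) •
        ((2 * Y) • KaehlerDifferential.D K (CoordRing e₄ e₆) Y) := by
    have ha : alpha e₄ e₆ = (-δ * (18 * g2 * X - 27 * g3) * Y) •
          KaehlerDifferential.D K (CoordRing e₄ e₆) X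
        + (2 * δ * (6 * g2 * X ^ 2 - 9 * g3 * X - g2 ^ 2)) •
          KaehlerDifferential.D K (CoordRing e₄ e₆) Y := rfl
    rw [ha]
    module
  rw [key, hd, smul_smul, ← add_smul, hy]
  refine (congrArg (· • KaehlerDifferential.D K (CoordRing e₄ e₆) X) ?_).trans (one_smul _ _)
  linear_combination hδ1

/-- `β = x dx / y`. -/
def beta : Ω[CoordRing e₄ e₆⁄K] := x e₄ e₆ • alpha e₄ e₆

/-- `ε m = e_{2m}`, where `e_n` is `1/(n-1)` times the coefficient of `z^{n-2}` in the Laurent series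
of `℘`, given by the classical recurrence
`(1/3)(m-3)(4m²-1) e_{2m} = ∑_{r=2}^{m-2} (2r-1)(2m-2r-1) e_{2r} e_{2m-2r}` for `m ≥ 4`. -/
def eEven (m : ℕ) : K :=
  if m < 2 then 0 else if m = 2 then e₄ else if m = 3 then e₆ else
    3 / (((m : K) - 3) * (4 * (m : K) ^ 2 - 1)) *
      ∑ r ∈ (Finset.Icc 2 (m - 2)).attach,
        (2 * (r.1 : K) - 1) * (2 * (m : K) - 2 * (r.1 : K) - 1) * eEven r.1 * eEven (m - r.1)
termination_by m
decreasing_by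
  all_goals
    have := Finset.mem_Icc.1 r.2
    omega

/-- The constants `e_n`; they vanish for odd `n`, and `e_2 = 0`. -/
def e (n : ℕ) : K := if Even n then eEven e₄ e₆ (n / 2) else 0

/-- The derivation `d/dz` on polynomials in `℘ = X 0` and `℘' = X 1`: it sends `℘` to `℘'` and `℘'` to
`℘'' = 6 ℘² - 30 e₄`. -/
def ddz : Derivation K (MvPolynomial (Fin 2) K) (MvPolynomial (Fin 2) K) :=
  MvPolynomial.mkDerivation K
    ![MvPolynomial.X 1, 6 * MvPolynomial.X 0 ^ 2 - MvPolynomial.C (30 * e₄)]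

/-- The function `P_k = ℘_k - e_k` on `X` (`k ≥ 2`), where `℘ = x`, `℘' = y` and
`℘_k = ((-1)^k / (k-1)!) d^{k-2} ℘ / dz^{k-2}`. -/
def P (k : ℕ) : CoordRing e₄ e₆ :=
  MvPolynomial.aeval ![x e₄ e₆, y e₄ e₆]
    (((-1 : K) ^ k / ((k - 1).factorial : K)) • ((ddz e₄)^[k - 2] (MvPolynomial.X 0)))
  - algebraMap K _ (e e₄ e₆ k)

/-- The power series `-∑_{k ≥ 2} (-1)^k P_k t^k / k`. -/
def kzbExponent : PowerSeries (CoordRing e₄ e₆) :=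
  PowerSeries.mk fun k =>
    if k < 2 then 0 else -(algebraMap K _ ((-1 : K) ^ k / (k : K)) * P e₄ e₆ k)

/-- `p_n`, the coefficient of `t^n` in `exp(-∑_{k ≥ 2} (-1)^k P_k t^k / k)`. -/
def p [CharZero K] (n : ℕ) : CoordRing e₄ e₆ :=
  PowerSeries.coeff n
    (PowerSeries.subst (kzbExponent e₄ e₆) (PowerSeries.exp K) : PowerSeries (CoordRing e₄ e₆))

/-- The noncommutative polynomial `ad_B^n(A)`. -/
def adPow (R : Type u) [CommRing R] (n : ℕ) : MonoidAlgebra R (FreeMonoid (Fin 2)) :=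
  (fun s => ⁅MonoidAlgebra.of R _ (FreeMonoid.of (1 : Fin 2)), s⁆)^[n]
    (MonoidAlgebra.of R _ (FreeMonoid.of (0 : Fin 2)))

/-- `ω₀ = α A + β B`. -/
def omegaNaive : Series (Ω[CoordRing e₄ e₆⁄K]) :=
  Pi.single [0] (alpha e₄ e₆) + Pi.single [1] (beta e₄ e₆)

/-- `ω_KZB = β B + α exp(-∑_{k ≥ 2} (-1)^k P_k ad_B^k / k) A = β B + α ∑_{n ≥ 0} p_n ad_B^n(A)`.
As `ad_B^n(A)` is homogeneous of degree `n + 1`, only terms with `n < |w|` have a nonzero coefficient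
at the word `w`. -/
def omegaKZB [CharZero K] : Series (Ω[CoordRing e₄ e₆⁄K]) :=
  Pi.single [1] (beta e₄ e₆) + fun w =>
    (∑ n ∈ Finset.range w.length,
      p e₄ e₆ n * (adPow (CoordRing e₄ e₆) n).coeff (FreeMonoid.ofList w)) • alpha e₄ e₆

end EllipticCurve

end KZB

end

noncomputable section

namespace KZB

/-! ### Unipotence of the truncations `(d + ω)_n` -/

section Unipotent

variable {K R : Type u} [CommRing K] [CommRing R] [Algebra K R]

/-! Only the coefficients of `ω` at the letters matter, and they matter only through their classes
in de Rham cohomology. A morphism from `(O⟨⟨A,B⟩⟩, d + ω)` to `V` is a finitely supported family `ψ`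
of sections, indexed by words, with `∇ ψ(v) = ∑_u ω_u ⊗ ψ(uv)`. Thus morphisms form the kernel of
the two-term complex whose differential is `dualDiff`.

For `V = O` this complex has kernel `K`, sitting at the empty word, and cokernel zero, as soon as
`ω` has no constant term, `H⁰ = K`, and the letter coefficients form a basis of `H¹`
(`IsCohomologyBasis`). The reason is a descent on word length. At the longest words a class in `H¹`
is removed by choosing constants one letter further out (`exists_primitive`), and conversely linear
independence of the classes forces the top coefficients of a horizontal family to vanish
(`vanishesFrom_one`). A diagram chase along extensions by `O` (`HasUniqueLifts.extension`) shows
that for every unipotent `V` the cokernel still vanishes and the kernel maps bijectively to the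
fibre `V_b`. With unipotence of the truncations, this is the universal property
(`IsCohomologyBasis.representsUniversal`).

On the curve, `O_X = K[x] ⊕ K[x] y`, `Ω¹` is free on `α`, and `d(q + s y) = (s' p + s p'/2 + q' y)
α` with `p` the cubic. The `y`-part of a form is always exact. The map `s ↦ s' p + s p'/2` raises
degree by exactly 2 in characteristic 0, so it is injective with cokernel spanned by `1` and `x`:
the classes of `α` and `β` form a basis of `H¹` (`isCohomologyBasis_of_letters`). The letter
coefficients of the KZB form are `α` and `β` because `p_0 = 1` and `ad_B^n(A)` has degree `n + 1`.
Part (2) follows since universal pointed objects are unique up to isomorphism; a global sign does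
not affect being a basis. -/

theorem trivialConnection_apply (r : R) :
    (trivialConnection K R).toFun r = KaehlerDifferential.D K R r ⊗ₜ[R] (1 : R) := rfl

/-- The connection `d + Θ` on a finite free module. -/
def matrixConnection {ι : Type} [Fintype ι] [DecidableEq ι] (Θ : ι → ι → Ω[R⁄K]) :
    Connection K R (ι → R) where
  toFun :=
    { toFun := fun s => ∑ v, (KaehlerDifferential.D K R (s v) + ∑ w, s w • Θ v w) ⊗ₜ[R]
        (Pi.single v 1 : ι → R)
      map_zero' := by simp
      map_add' := fun s t => by
        rw [← Finset.sum_add_distrib]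
        refine Finset.sum_congr rfl fun v _ => ?_
        rw [← TensorProduct.add_tmul]
        congr 1
        simp only [Pi.add_apply, map_add, add_smul, Finset.sum_add_distrib]
        abel }
  leibniz r s := by
    have hs : s = ∑ v, s v • (Pi.single v 1 : ι → R) := by
      ext w
      simp [Finset.sum_apply, Pi.single_apply]
    change (∑ v, _) = _ + r • ∑ v, _
    conv_rhs => rw [hs, TensorProduct.tmul_sum]
    rw [Finset.smul_sum, ← Finset.sum_add_distrib]
    refine Finset.sum_congr rfl fun v _ => ?_
    rw [TensorProduct.tmul_smul, TensorProduct.smul_tmul', TensorProduct.smul_tmul',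
      ← TensorProduct.add_tmul]
    congr 1
    simp only [Pi.smul_apply, smul_eq_mul, Derivation.leibniz, smul_add, Finset.smul_sum, smul_smul]
    rw [← hs]
    abel

theorem matrixConnection_apply {ι : Type} [Fintype ι] [DecidableEq ι] (Θ : ι → ι → Ω[R⁄K])
    (s : ι → R) :
    (matrixConnection Θ).toFun s = ∑ v, (KaehlerDifferential.D K R (s v) + ∑ w, s w • Θ v w) ⊗ₜ[R]
        (Pi.single v 1 : ι → R) := rfl

/-- Extension by zero of functions on the complement of a point. -/
def extendCompl {ι : Type} [DecidableEq ι] (j : ι) : ({i : ι // i ≠ j} → R) →ₗ[R] (ι → R) where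
  toFun s v := if h : v ≠ j then s ⟨v, h⟩ else 0
  map_add' s t := by ext v; by_cases h : v = j <;> simp [h]
  map_smul' r s := by ext v; by_cases h : v = j <;> simp [h]

theorem extendCompl_self {ι : Type} [DecidableEq ι] (j : ι) (s : {i : ι // i ≠ j} → R) :
    extendCompl j s j = 0 := by simp [extendCompl]

theorem extendCompl_coe {ι : Type} [DecidableEq ι] (j : ι) (s : {i : ι // i ≠ j} → R)
    (v : {i : ι // i ≠ j}) : extendCompl j s v = s v := by simp [extendCompl, v.2]

theorem extendCompl_single {ι : Type} [DecidableEq ι] (j : ι) (v : {i : ι // i ≠ j}) :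
    extendCompl j (Pi.single v 1 : _ → R) = Pi.single v.1 1 := by
  ext w
  by_cases h : w = j
  · subst h
    rw [extendCompl_self, Pi.single_eq_of_ne v.2.symm]
  · have := extendCompl_coe j (Pi.single v 1 : _ → R) ⟨w, h⟩
    simp only at this
    rw [this]
    simp [Pi.single_apply, Subtype.ext_iff]

theorem sum_eq_add_sum_ne {ι A : Type*} [Fintype ι] [DecidableEq ι] [AddCommMonoid A] (j : ι)
    (f : ι → A) : ∑ v, f v = f j + ∑ v : {i : ι // i ≠ j}, f v := by
  rw [← Finset.add_sum_erase _ f (Finset.mem_univ j)]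
  congr 1
  exact Finset.sum_subtype _ (by simp) f

/-- A connection on a finite free module whose matrix is strictly triangular with respect to a
grading of the index set is unipotent. -/
theorem isUnipotent_matrixConnection (k : ℕ) : ∀ {ι : Type} [Fintype ι] [DecidableEq ι]
    (Θ : ι → ι → Ω[R⁄K]) (deg : ι → ℕ), (∀ v w, deg v ≤ deg w → Θ v w = 0) →
    Fintype.card ι = k → IsUnipotent (ι → R) (matrixConnection Θ) := by
  induction k with
  | zero =>
    intro ι _ _ Θ deg _ hk
    have := Fintype.card_eq_zero_iff.1 hk
    exact .zero _ _
  | succ k ih =>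
    intro ι _ _ Θ deg hΘ hk
    have : Nonempty ι := Fintype.card_pos_iff.1 (by omega)
    -- At an index of minimal degree the whole row of `Θ` vanishes. Hence the `j`-th coordinate is a
    -- horizontal map to `(O, d)`, with kernel the functions vanishing at `j`.
    obtain ⟨j, hj⟩ := Finite.exists_min deg
    refine .extension ({i : ι // i ≠ j} → R) (ι → R)
      (matrixConnection fun v w => Θ v w) (matrixConnection Θ) (extendCompl j)
      (LinearMap.proj j) ?_ ?_ ?_ ?_ ?_ (ih _ (fun v => deg v) (fun v w => hΘ v w) ?_)
    · intro s t hst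
      ext v
      rw [← extendCompl_coe j s v, hst, extendCompl_coe]
    · intro s
      constructor
      · intro hs
        refine ⟨fun v => s v, ?_⟩
        ext v
        by_cases h : v = j
        · subst h
          rw [extendCompl_self]
          exact hs.symm
        · exact extendCompl_coe j (fun v => s v) ⟨v, h⟩
      · rintro ⟨t, rfl⟩
        exact extendCompl_self j t
    · intro r
      exact ⟨fun _ => r, rfl⟩
    · intro s
      rw [matrixConnection_apply, matrixConnection_apply, map_sum, sum_eq_add_sum_ne j,
        extendCompl_self, map_zero, zero_add]
      have h0 : ∑ w, extendCompl j s w • Θ j w = 0 :=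
        Finset.sum_eq_zero fun w _ => by rw [hΘ j w (hj w), smul_zero]
      rw [h0, TensorProduct.zero_tmul, zero_add]
      refine Finset.sum_congr rfl fun v _ => ?_
      rw [LinearMap.lTensor_tmul, extendCompl_single, extendCompl_coe, sum_eq_add_sum_ne j,
        extendCompl_self, zero_smul, zero_add]
      simp only [extendCompl_coe]
    · intro s
      rw [matrixConnection_apply, map_sum, sum_eq_add_sum_ne j, trivialConnection_apply]
      have h0 : ∑ w, s w • Θ j w = 0 :=
        Finset.sum_eq_zero fun w _ => by rw [hΘ j w (hj w), smul_zero]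
      rw [h0, add_zero, LinearMap.lTensor_tmul, Finset.sum_eq_zero]
      · simp
      · intro v _
        rw [LinearMap.lTensor_tmul, LinearMap.proj_apply, Pi.single_eq_of_ne v.2.symm,
          TensorProduct.tmul_zero]
    · have := Fintype.card_subtype_compl (fun i => i = j)
      simp only [Fintype.card_subtype_eq] at this
      simp only [ne_eq]
      omega

theorem isUnipotent_truncConnection (ω : Series (Ω[R⁄K])) (h : ω [] = 0) (n : ℕ) :
    IsUnipotent (WordLE n → R) (truncConnection ω n) := by
  classical
  -- The matrix entry at `(v, w)` is `ω_u` if `v = u w`, and zero if `w` is not a suffix of `v`.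
  have key : truncConnection (R := R) ω n = matrixConnection fun v w : WordLE n =>
      ∑ i ∈ Finset.range (v.1.length + 1), if v.1.drop i = w.1 then ω (v.1.take i) else 0 := by
    have : ∀ n₁ n₂ : Connection K R (WordLE n → R), n₁.toFun = n₂.toFun → n₁ = n₂ := by
      rintro ⟨_, _⟩ ⟨_, _⟩ rfl
      rfl
    refine this _ _ (AddMonoidHom.ext fun s => ?_)
    refine Finset.sum_congr rfl fun v _ => ?_
    congr 2
    simp only [Finset.smul_sum]
    rw [Finset.sum_comm]
    refine Finset.sum_congr rfl fun i _ => ?_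
    rw [Finset.sum_eq_single ⟨v.1.drop i, (by simpa using Nat.le_add_right_of_le v.2)⟩]
    · simp
    · intro w _ hw
      rw [if_neg, smul_zero]
      exact fun h => hw (Subtype.ext h.symm)
    · simp
  rw [key]
  refine isUnipotent_matrixConnection _ _ (fun v => v.1.length) ?_ rfl
  intro v w hvw
  refine Finset.sum_eq_zero fun i hi => ?_
  split_ifs with h'
  -- A suffix of `v` at least as long as `v` is `v` itself, so only the constant term of `ω`
  -- contributes.
  · have : i = 0 := by
      have h2 := congrArg List.length h'
      rw [List.length_drop] at h2
      have := Finset.mem_range.1 hi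
      omega
    rw [this, List.take_zero, h]
  · rfl

end Unipotent

/-! ### Sums over words of bounded length -/

section Words

/-- The finite set of words of length at most `n`. -/
def wordsLE (n : ℕ) : Finset Word := (List.finite_length_le (Fin 2) n).toFinset

theorem mem_wordsLE {n : ℕ} {w : Word} : w ∈ wordsLE n ↔ w.length ≤ n := by simp [wordsLE]

theorem sum_wordLE {A : Type*} [AddCommMonoid A] (n : ℕ) (f : Word → A) :
    ∑ w : WordLE n, f w = ∑ w ∈ wordsLE n, f w :=
  (Finset.sum_subtype _ (fun _ => mem_wordsLE) f).symm

theorem sum_wordsLE_of_le {A : Type*} [AddCommMonoid A] {m n : ℕ} (h : m ≤ n) (f : Word → A)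
    (hf : ∀ w, m < w.length → f w = 0) : ∑ w ∈ wordsLE n, f w = ∑ w ∈ wordsLE m, f w := by
  refine (Finset.sum_subset (fun w hw => ?_) fun w _ hw => hf w ?_).symm
  · exact mem_wordsLE.2 ((mem_wordsLE.1 hw).trans h)
  · simpa [mem_wordsLE] using hw

theorem word_of_length_pos {w : Word} (h : 0 < w.length) : ∃ v : Word, w = 0 :: v ∨ w = 1 :: v := by
  match w, h with
  | a :: v, _ =>
    refine ⟨v, ?_⟩
    fin_cases a
    · exact Or.inl rfl
    · exact Or.inr rfl

theorem sum_wordsLE_letters {A : Type*} [AddCommMonoid A] {n : ℕ} (hn : 1 ≤ n) (f : Word → A)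
    (h0 : f [] = 0) (hf : ∀ w, 2 ≤ w.length → f w = 0) :
    ∑ w ∈ wordsLE n, f w = f [0] + f [1] := by
  classical
  rw [← Finset.sum_pair (show ([0] : Word) ≠ [1] by decide)]
  refine (Finset.sum_subset (fun w hw => ?_) fun w _ hw => ?_).symm
  · rw [mem_wordsLE]
    simp only [Finset.mem_insert, Finset.mem_singleton] at hw
    rcases hw with rfl | rfl <;> simpa using hn
  · by_cases h2 : 2 ≤ w.length
    · exact hf w h2
    · by_cases h1 : w.length = 0
      · rw [List.length_eq_zero_iff.1 h1, h0]
      · obtain ⟨v, hv⟩ := word_of_length_pos (Nat.pos_of_ne_zero h1)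
        have hv0 : v = [] := by
          rcases hv with rfl | rfl <;>
          · simp only [List.length_cons] at h2
            exact List.length_eq_zero_iff.1 (by omega)
        subst hv0
        exact absurd (by simpa using hv) hw

/-- Summation over factorizations `w = u v` of words of bounded length. -/
theorem sum_wordsLE_factor {A : Type*} [AddCommMonoid A] (n : ℕ) (F : Word → Word → A)
    (hF : ∀ u v, n < (u ++ v).length → F u v = 0) :
    ∑ w ∈ wordsLE n, ∑ i ∈ Finset.range (w.length + 1), F (w.take i) (w.drop i)
      = ∑ v ∈ wordsLE n, ∑ u ∈ wordsLE n, F u v := by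
  classical
  have hR : ∑ v ∈ wordsLE n, ∑ u ∈ wordsLE n, F u v
      = ∑ q ∈ (wordsLE n ×ˢ wordsLE n).filter (fun q => (q.2 ++ q.1).length ≤ n), F q.2 q.1 := by
    rw [← Finset.sum_product', Finset.sum_filter_of_ne]
    intro q _ hq
    by_contra hlt
    exact hq (hF _ _ (not_le.1 hlt))
  rw [hR, Finset.sum_sigma']
  refine Finset.sum_bij' (fun q _ => (q.1.drop q.2, q.1.take q.2))
    (fun q _ => ⟨q.2 ++ q.1, q.2.length⟩) ?_ ?_ ?_ ?_ ?_
  · rintro ⟨w, i⟩ h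
    simp only [Finset.mem_sigma, mem_wordsLE, Finset.mem_range] at h
    simp only [Finset.mem_filter, Finset.mem_product, mem_wordsLE, List.take_append_drop,
      List.length_drop, List.length_take]
    omega
  · rintro ⟨v, u⟩ h
    simp only [Finset.mem_filter, Finset.mem_product, mem_wordsLE, List.length_append] at h
    simp only [Finset.mem_sigma, mem_wordsLE, Finset.mem_range, List.length_append]
    omega
  · rintro ⟨w, i⟩ h
    simp only [Finset.mem_sigma, mem_wordsLE, Finset.mem_range] at h
    simp only [List.take_append_drop, List.length_take]
    congr 1
    omega
  · rintro ⟨v, u⟩ _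
    simp
  · rintro ⟨w, i⟩ _
    rfl

/-- Functions on words that vanish on all words of length at least `n`. -/
def VanishesFrom {A : Type*} [Zero A] (n : ℕ) (f : Word → A) : Prop :=
  ∀ w, n ≤ w.length → f w = 0

theorem VanishesFrom.mono {A : Type*} [Zero A] {m n : ℕ} {f : Word → A} (hf : VanishesFrom m f)
    (h : m ≤ n) : VanishesFrom n f := fun w hw => hf w (h.trans hw)

theorem VanishesFrom.add {A : Type*} [AddCommGroup A] {n : ℕ} {f g : Word → A}
    (hf : VanishesFrom n f) (hg : VanishesFrom n g) : VanishesFrom n (f + g) := fun w hw => by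
  rw [Pi.add_apply, hf w hw, hg w hw, add_zero]

theorem VanishesFrom.sub {A : Type*} [AddCommGroup A] {n : ℕ} {f g : Word → A}
    (hf : VanishesFrom n f) (hg : VanishesFrom n g) : VanishesFrom n (f - g) := fun w hw => by
  rw [Pi.sub_apply, hf w hw, hg w hw, sub_zero]

theorem VanishesFrom.comp {A B F : Type*} [AddCommGroup A] [AddCommGroup B] [FunLike F A B]
    [AddMonoidHomClass F A B] {n : ℕ} {f : Word → A} (hf : VanishesFrom n f) (g : F) :
    VanishesFrom n (fun w => g (f w)) := fun w hw => by
  simp only [hf w hw, map_zero]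

end Words

/-! ### The complex computing morphisms, and its cohomology for `V = O` -/

section DualComplex

variable {K R : Type u} [CommRing K] [CommRing R] [Algebra K R]
  {V : Type u} [AddCommGroup V] [Module R V] {W : Type u} [AddCommGroup W] [Module R W]

/-- The differential `Hom(O⟨⟨A,B⟩⟩, V) → Hom(O⟨⟨A,B⟩⟩, Ω¹ ⊗ V)` in terms of the values at the
words; its kernel consists of the morphisms of connections. -/
def dualDiff (ω : Series (Ω[R⁄K])) (nabla : Connection K R V) (n : ℕ) (ψ : Word → V) :
    Word → Ω[R⁄K] ⊗[R] V := fun v =>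
  nabla.toFun (ψ v) - ∑ u ∈ wordsLE n, ω u ⊗ₜ[R] ψ (u ++ v)

variable (ω : Series (Ω[R⁄K])) (nabla : Connection K R V)

theorem dualDiff_add (n : ℕ) (ψ χ : Word → V) :
    dualDiff ω nabla n (ψ + χ) = dualDiff ω nabla n ψ + dualDiff ω nabla n χ := by
  ext v
  simp only [dualDiff, Pi.add_apply, map_add, TensorProduct.tmul_add, Finset.sum_add_distrib]
  abel

theorem dualDiff_sub (n : ℕ) (ψ χ : Word → V) :
    dualDiff ω nabla n (ψ - χ) = dualDiff ω nabla n ψ - dualDiff ω nabla n χ := by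
  ext v
  simp only [dualDiff, Pi.sub_apply, map_sub, TensorProduct.tmul_sub, Finset.sum_sub_distrib]
  abel

theorem VanishesFrom.dualDiff {n : ℕ} {ψ : Word → V} (hψ : VanishesFrom n ψ) (m : ℕ) :
    VanishesFrom n (dualDiff ω nabla m ψ) := fun v hv => by
  rw [KZB.dualDiff, hψ v hv, map_zero, Finset.sum_eq_zero, sub_zero]
  intro u _
  rw [hψ _ (by rw [List.length_append]; omega), TensorProduct.tmul_zero]

/-- The cut-off in `dualDiff` only serves to make the sum finite; past the support of `ψ` it is
immaterial. -/
theorem dualDiff_of_le {m n : ℕ} {ψ : Word → V} (hψ : VanishesFrom m ψ) (h : m ≤ n) :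
    dualDiff ω nabla n ψ = dualDiff ω nabla m ψ := by
  ext v
  rw [dualDiff, dualDiff, sum_wordsLE_of_le h]
  intro w hw
  rw [hψ _ (by rw [List.length_append]; omega), TensorProduct.tmul_zero]

theorem dualDiff_comp {nabla} {nabla' : Connection K R W} {φ : V →ₗ[R] W}
    (hφ : IsHorizontal nabla nabla' φ) (n : ℕ) (ψ : Word → V) :
    dualDiff ω nabla' n (fun w => φ (ψ w))
      = fun v => φ.lTensor (Ω[R⁄K]) (dualDiff ω nabla n ψ v) := by
  ext v
  simp only [dualDiff, map_sub, map_sum, LinearMap.lTensor_tmul, hφ (ψ v)]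

theorem dualDiff_trivialConnection (n : ℕ) (ψ : Word → R) (v : Word) :
    dualDiff ω (trivialConnection K R) n ψ v
      = (KaehlerDifferential.D K R (ψ v) - ∑ u ∈ wordsLE n, ψ (u ++ v) • ω u) ⊗ₜ[R] (1 : R) := by
  rw [dualDiff, trivialConnection_apply, TensorProduct.sub_tmul, TensorProduct.sum_tmul]
  congr 1
  refine Finset.sum_congr rfl fun u _ => ?_
  rw [TensorProduct.smul_tmul, smul_eq_mul, mul_one]

/-- The components of `ω` at the letters form a basis of the first de Rham cohomology, and `ω` has
no constant term; moreover, functions with zero differential are constant. -/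
structure IsCohomologyBasis (ω : Series (Ω[R⁄K])) : Prop where
  nil : ω [] = 0
  exists_algebraMap : ∀ r : R, KaehlerDifferential.D K R r = 0 → ∃ c : K, algebraMap K R c = r
  span : ∀ η : Ω[R⁄K], ∃ (c₀ c₁ : K) (f : R), η = KaehlerDifferential.D K R f
    + algebraMap K R c₀ • ω [0] + algebraMap K R c₁ • ω [1]
  indep : ∀ (c₀ c₁ : K) (f : R), algebraMap K R c₀ • ω [0] + algebraMap K R c₁ • ω [1]
    = KaehlerDifferential.D K R f → c₀ = 0 ∧ c₁ = 0

variable {ω}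

/-- Descent on the length of the longest words in the support of `η`: a correction `ψ₁` solves the
equation at those words, and the error it causes lives on shorter ones. -/
theorem IsCohomologyBasis.exists_primitive (h : IsCohomologyBasis ω) (n : ℕ) :
    ∀ η : Word → Ω[R⁄K], VanishesFrom n η → ∃ ψ : Word → R, VanishesFrom (n + 1) ψ ∧
      ∀ v, KaehlerDifferential.D K R (ψ v) - ∑ u ∈ wordsLE (n + 1), ψ (u ++ v) • ω u = η v := by
  induction n with
  | zero =>
    intro η hη
    exact ⟨0, fun _ _ => rfl, fun v => by simp [hη v (Nat.zero_le _)]⟩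
  | succ n ih =>
    intro η hη
    choose c₀ c₁ f hf using fun v => h.span (η v)
    -- For `|v| = n` and `η(v) = df + c₀ ω_A + c₁ ω_B`, take `ψ₁(v) = f`, `ψ₁(Av) = -c₀`, `ψ₁(Bv) =
    -- -c₁`. The values one letter further out are constants, so they produce no new differential
    -- there.
    let ψ₁ : Word → R := fun w => if w.length = n then f w else if w.length = n + 1 then
      (if w.head? = some 0 then algebraMap K R (-c₀ w.tail) else algebraMap K R (-c₁ w.tail)) else 0
    have hψ₁ : VanishesFrom (n + 2) ψ₁ := fun w hw => by
      simp only [ψ₁]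
      rw [if_neg (by omega), if_neg (by omega)]
    have h0 : ∀ v : Word, v.length = n → ψ₁ (0 :: v) = algebraMap K R (-c₀ v) := fun v hv => by
      simp [ψ₁, hv]
    have h1 : ∀ v : Word, v.length = n → ψ₁ (1 :: v) = algebraMap K R (-c₁ v) := fun v hv => by
      simp [ψ₁, hv]
    have hf₁ : ∀ v : Word, v.length = n → ψ₁ v = f v := fun v hv => by
      simp [ψ₁, hv]
    have hD : ∀ v : Word, v.length = n + 1 → KaehlerDifferential.D K R (ψ₁ v) = 0 := fun v hv => by
      simp only [ψ₁]
      rw [if_neg (by omega), if_pos hv]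
      split_ifs <;> exact Derivation.map_algebraMap _ _
    have hsum : ∀ v : Word, n ≤ v.length → ∑ u ∈ wordsLE (n + 2), ψ₁ (u ++ v) • ω u
        = ψ₁ (0 :: v) • ω [0] + ψ₁ (1 :: v) • ω [1] := fun v hv => by
      rw [sum_wordsLE_letters (by omega)]
      · rfl
      · rw [h.nil, smul_zero]
      · intro w hw
        rw [hψ₁ _ (by rw [List.length_append]; omega), zero_smul]
    obtain ⟨ψ₂, hψ₂, hψ₂'⟩ := ih (fun v => η v - (KaehlerDifferential.D K R (ψ₁ v)
        - ∑ u ∈ wordsLE (n + 2), ψ₁ (u ++ v) • ω u)) (by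
      intro v hv
      simp only [hsum v hv]
      rcases hv.lt_or_eq with hlt | heq
      · rw [hη v hlt, hψ₁ (0 :: v) (by rw [List.length_cons]; omega),
          hψ₁ (1 :: v) (by rw [List.length_cons]; omega)]
        have : KaehlerDifferential.D K R (ψ₁ v) = 0 := by
          by_cases hv' : v.length = n + 1
          · exact hD v hv'
          · rw [hψ₁ v (by omega), map_zero]
        rw [this]
        simp
      · rw [h0 v heq.symm, h1 v heq.symm, hf₁ v heq.symm, hf v, map_neg, map_neg]
        module)
    refine ⟨ψ₁ + ψ₂, hψ₁.add (hψ₂.mono (by omega)), fun v => ?_⟩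
    have := hψ₂' v
    rw [← sum_wordsLE_of_le (show n + 1 ≤ n + 2 by omega) (fun u => ψ₂ (u ++ v) • ω u) (by
      intro w hw
      rw [hψ₂ _ (by rw [List.length_append]; omega), zero_smul])] at this
    simp only [Pi.add_apply, map_add, add_smul, Finset.sum_add_distrib]
    rw [eq_sub_iff_add_eq] at this
    rw [← this]
    abel

/-- A horizontal family has constant values at its longest words. One letter lower these constants
give a combination of `ω_A` and `ω_B` that is exact, hence trivial; this strips off the longest
words until only the empty word is left. -/
theorem IsCohomologyBasis.vanishesFrom_one (h : IsCohomologyBasis ω) {m : ℕ} {ψ : Word → R}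
    (hm : 1 ≤ m)
    (hψ : ∀ v, KaehlerDifferential.D K R (ψ v) - ∑ u ∈ wordsLE m, ψ (u ++ v) • ω u = 0) (n : ℕ) :
    VanishesFrom (n + 1) ψ → VanishesFrom 1 ψ := by
  induction n with
  | zero => exact id
  | succ n ih =>
    intro hn
    apply ih
    have hc : ∀ w : Word, w.length = n + 1 → ∃ c : K, algebraMap K R c = ψ w := fun w hw => by
      refine h.exists_algebraMap _ ?_
      have := hψ w
      rwa [Finset.sum_eq_zero, sub_zero] at this
      intro u _
      by_cases hu : u = []
      · rw [hu, h.nil, smul_zero]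
      · have := List.length_pos_iff.2 hu
        rw [hn _ (by rw [List.length_append]; omega), zero_smul]
    have hz : ∀ v : Word, v.length = n → ψ (0 :: v) = 0 ∧ ψ (1 :: v) = 0 := fun v hv => by
      obtain ⟨c₀, h₀⟩ := hc (0 :: v) (by simp [hv])
      obtain ⟨c₁, h₁⟩ := hc (1 :: v) (by simp [hv])
      have := hψ v
      -- The bound `1 ≤ m` ensures that both letters occur in the sum.
      rw [sum_wordsLE_letters hm] at this
      · have := h.indep c₀ c₁ (ψ v) (by
          rw [h₀, h₁]
          exact (sub_eq_zero.1 this).symm)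
        rw [← h₀, ← h₁, this.1, this.2, map_zero]
        exact ⟨rfl, rfl⟩
      · rw [h.nil, smul_zero]
      · intro w hw
        rw [hn _ (by rw [List.length_append]; omega), zero_smul]
    intro w hw
    rcases hw.lt_or_eq with hlt | heq
    · exact hn w hlt
    · obtain ⟨v, hv⟩ := word_of_length_pos (w := w) (by omega)
      rcases hv with rfl | rfl
      · exact (hz v (by simpa using heq.symm)).1
      · exact (hz v (by simpa using heq.symm)).2

end DualComplex

/-! ### Dévissage along extensions by the trivial connection -/

section Lifting

variable {K R : Type u} [CommRing K] [CommRing R] [Algebra K R]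
  {ω : Series (Ω[R⁄K])}

/-- The evaluation of horizontal maps `O⟨⟨A,B⟩⟩ → V` at `1` over `b` is bijective, and the first
extension group of `O⟨⟨A,B⟩⟩` by `V` vanishes. -/
structure HasUniqueLifts (b : R →ₐ[K] K) (ω : Series (Ω[R⁄K])) {V : Type u} [AddCommGroup V]
    [Module R V] (nabla : Connection K R V) : Prop where
  acyclic : ∀ (n : ℕ) (η : Word → Ω[R⁄K] ⊗[R] V), VanishesFrom n η →
    ∃ (m : ℕ) (ψ : Word → V), 1 ≤ m ∧ VanishesFrom m ψ ∧ dualDiff ω nabla m ψ = η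
  exists_lift : ∀ v : V, ∃ (m : ℕ) (ψ : Word → V), 1 ≤ m ∧ VanishesFrom m ψ ∧
    dualDiff ω nabla m ψ = 0 ∧ ψ [] - v ∈ RingHom.ker b • (⊤ : Submodule R V)
  eq_zero : ∀ (m : ℕ) (ψ : Word → V), 1 ≤ m → VanishesFrom m ψ → dualDiff ω nabla m ψ = 0 →
    ψ [] ∈ RingHom.ker b • (⊤ : Submodule R V) → ψ = 0

theorem map_mem_ker_smul_top (b : R →ₐ[K] K) {V W : Type u} [AddCommGroup V] [Module R V]
    [AddCommGroup W] [Module R W] (φ : V →ₗ[R] W) {v : V}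
    (hv : v ∈ RingHom.ker b • (⊤ : Submodule R V)) :
    φ v ∈ RingHom.ker b • (⊤ : Submodule R W) := by
  have := Submodule.mem_map_of_mem (f := φ) hv
  rw [Submodule.map_smul''] at this
  exact Submodule.smul_mono le_rfl le_top this

theorem mem_ker_of_mem_ker_smul_top (b : R →ₐ[K] K) {r : R}
    (h : r ∈ RingHom.ker b • (⊤ : Submodule R R)) : b r = 0 := by
  rw [smul_eq_mul, Ideal.mul_top] at h
  exact h

theorem eq_zero_of_tmul_one {M : Type u} [AddCommGroup M] [Module R M] {m : M}
    (h : m ⊗ₜ[R] (1 : R) = 0) : m = 0 := by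
  have := congrArg (TensorProduct.rid R M) h
  rwa [TensorProduct.rid_tmul, one_smul, map_zero] at this

theorem exists_tmul_one {M : Type u} [AddCommGroup M] [Module R M] (t : M ⊗[R] R) :
    t = TensorProduct.rid R M t ⊗ₜ[R] (1 : R) :=
  ((TensorProduct.rid R M).symm_apply_apply t).symm

theorem IsCohomologyBasis.dualDiff_single (h : IsCohomologyBasis ω) (c : K) (m : ℕ) :
    dualDiff ω (trivialConnection K R) m (Pi.single [] (algebraMap K R c)) = 0 := by
  ext v
  rw [dualDiff_trivialConnection, Finset.sum_eq_zero]
  · by_cases hv : v = []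
    · subst hv
      simp
    · rw [Pi.single_eq_of_ne hv, map_zero, sub_zero, TensorProduct.zero_tmul]
      rfl
  · intro u _
    by_cases hu : u = []
    · rw [hu, h.nil, smul_zero]
    · rw [Pi.single_eq_of_ne (by simp [hu]), zero_smul]

variable {M' M : Type u} [AddCommGroup M'] [Module R M'] [AddCommGroup M] [Module R M]

/-- Right exactness of `Ω¹ ⊗ -`, applied word by word; zero is lifted to zero on long words, so that
the support stays bounded. -/
theorem exists_lift_of_exact {i : M' →ₗ[R] M} {p : M →ₗ[R] R} (hex : Function.Exact i p)
    (hp : Function.Surjective p) {n : ℕ} {δ : Word → Ω[R⁄K] ⊗[R] M} (hδ : VanishesFrom n δ)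
    (h : ∀ v, p.lTensor (Ω[R⁄K]) (δ v) = 0) :
    ∃ η : Word → Ω[R⁄K] ⊗[R] M', VanishesFrom n η ∧ ∀ v, i.lTensor (Ω[R⁄K]) (η v) = δ v := by
  have : ∀ v, ∃ t, i.lTensor (Ω[R⁄K]) t = δ v ∧ (n ≤ v.length → t = 0) := fun v => by
    by_cases hv : n ≤ v.length
    · exact ⟨0, by rw [map_zero, hδ v hv], fun _ => rfl⟩
    · obtain ⟨t, ht⟩ := (lTensor_exact (Ω[R⁄K]) hex hp _).1 (h v)
      exact ⟨t, ht, fun h => absurd h hv⟩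
  choose η hη using this
  exact ⟨η, fun v => (hη v).2, fun v => (hη v).1⟩

/-- The five lemma for the complexes of `M'`, `M` and `O`, mapped to the fibres at `b`. The cokernel
for `M'` is zero, so horizontal families with values in `O` lift to `M`. -/
theorem HasUniqueLifts.extension {b : R →ₐ[K] K} (hω : IsCohomologyBasis ω)
    {nabla' : Connection K R M'} {nabla : Connection K R M}
    {i : M' →ₗ[R] M} {p : M →ₗ[R] R}
    (hi : Function.Injective i) (hex : Function.Exact i p) (hp : Function.Surjective p)
    (hori : IsHorizontal nabla' nabla i) (horp : IsHorizontal nabla (trivialConnection K R) p)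
    (h : HasUniqueLifts b ω nabla') : HasUniqueLifts b ω nabla := by
  obtain ⟨e, he⟩ := hp 1
  obtain ⟨q, hq⟩ : ∃ q : M →ₗ[R] M', q ∘ₗ i = LinearMap.id := by
    have hsplit : ∃ l : R →ₗ[R] M, p ∘ₗ l = LinearMap.id :=
      ⟨LinearMap.toSpanSingleton R M e, by ext; simp [he]⟩
    have htfae := (hex.split_tfae').out 0 1
    exact (htfae.1 ⟨hi, hsplit⟩).2
  have hqi : ∀ w, q (i w) = w := fun w => LinearMap.congr_fun hq w
  -- The sequence of modules splits because the quotient `R` is free, so tensoring with `Ω¹`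
  -- preserves injectivity.
  have hitens : Function.Injective (i.lTensor (Ω[R⁄K])) := by
    refine Function.LeftInverse.injective (g := q.lTensor (Ω[R⁄K])) fun t => ?_
    rw [← LinearMap.comp_apply, ← LinearMap.lTensor_comp, hq, LinearMap.lTensor_id]
    rfl
  -- A solution of `dualDiff ψ = η` after projection to `O` becomes a true solution after adding a
  -- family from `M'`.
  have hsubmul : ∀ (m n : ℕ) (ψ₁ : Word → M) (η : Word → Ω[R⁄K] ⊗[R] M), 1 ≤ m →
      VanishesFrom m ψ₁ → VanishesFrom n η →
      (∀ v, p.lTensor (Ω[R⁄K]) (η v - dualDiff ω nabla m ψ₁ v) = 0) →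
      ∃ (m' : ℕ) (ψ' : Word → M'), 1 ≤ m' ∧ VanishesFrom m' (ψ₁ + fun w => i (ψ' w)) ∧
        dualDiff ω nabla m' (ψ₁ + fun w => i (ψ' w)) = η := by
    intro m n ψ₁ η hm hψ₁ hη hpη
    obtain ⟨η', hη', hη''⟩ := exists_lift_of_exact hex hp (n := max m n)
      ((hη.mono (le_max_right _ _)).sub ((hψ₁.dualDiff ω nabla m).mono (le_max_left _ _))) hpη
    obtain ⟨k, ψ', hk, hψ', hψ''⟩ := h.acyclic _ η' hη'
    have hiψ' : VanishesFrom k (fun w => i (ψ' w)) := hψ'.comp i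
    refine ⟨max m k, ψ', hm.trans (le_max_left _ _), (hψ₁.mono (le_max_left _ _)).add
      (hiψ'.mono (le_max_right _ _)), ?_⟩
    rw [dualDiff_add, dualDiff_of_le ω nabla hψ₁ (le_max_left _ _),
      dualDiff_of_le ω nabla hiψ' (le_max_right _ _), dualDiff_comp ω hori, hψ'']
    ext v
    rw [Pi.add_apply, hη'', Pi.sub_apply, add_sub_cancel]
  refine ⟨?_, ?_, ?_⟩
  · intro n η hη
    obtain ⟨ψ₀, hψ₀, hψ₀'⟩ := hω.exists_primitive n
      (fun v => TensorProduct.rid R _ (p.lTensor (Ω[R⁄K]) (η v)))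
      ((hη.comp (p.lTensor (Ω[R⁄K]))).comp (TensorProduct.rid R _))
    have hv₁ : VanishesFrom (n + 1) (fun w => ψ₀ w • e) := fun w hw => by
      simp only [hψ₀ w hw, zero_smul]
    obtain ⟨m', ψ', h1, h2, h3⟩ := hsubmul (n + 1) n (fun w => ψ₀ w • e) η (by omega) hv₁ hη (by
      intro v
      have := congrFun (dualDiff_comp ω horp (n + 1) (fun w => ψ₀ w • e)) v
      rw [map_sub, ← this]
      simp only [map_smul, he, smul_eq_mul, mul_one]
      rw [dualDiff_trivialConnection, hψ₀', ← exists_tmul_one, sub_self])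
    exact ⟨m', _, h1, h2, h3⟩
  · intro v
    -- The horizontal family over `O` with the right value at `b` is the constant `c` at the empty
    -- word; it is lifted to `M` through `e` and then corrected.
    let c : K := b (p v)
    have hv₁ : VanishesFrom 1 (fun w => (Pi.single [] (algebraMap K R c) : Word → R) w • e) := by
      intro w hw
      simp only
      rw [Pi.single_eq_of_ne (List.length_pos_iff.1 hw), zero_smul]
    obtain ⟨m', ψ', h1, h2, h3⟩ := hsubmul 1 0
      (fun w => (Pi.single [] (algebraMap K R c) : Word → R) w • e) 0 le_rfl hv₁
      (fun _ _ => rfl) (by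
      intro v
      have := congrFun (dualDiff_comp ω horp 1
        (fun w => (Pi.single [] (algebraMap K R c) : Word → R) w • e)) v
      rw [map_sub, ← this]
      simp only [map_smul, he, smul_eq_mul, mul_one]
      rw [hω.dualDiff_single]
      simp)
    have hk : p v - algebraMap K R c ∈ RingHom.ker b := by
      rw [RingHom.mem_ker, map_sub, AlgHom.commutes]
      exact sub_self _
    -- The remaining discrepancy at the empty word, up to a multiple of `e` vanishing at `b`, comes
    -- from `M'`, where it is removed by a horizontal family.
    obtain ⟨v', hv'⟩ := (hex (v - (algebraMap K R c • e + i (ψ' []))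
      - (p v - algebraMap K R c) • e)).1 (by
      have : p (i (ψ' [])) = 0 := (hex _).2 ⟨_, rfl⟩
      simp only [map_sub, map_add, map_smul, he, smul_eq_mul, mul_one, this]
      ring)
    obtain ⟨k, ψ₃, hk1, hψ₃, hψ₃', hψ₃''⟩ := h.exists_lift v'
    have hiψ₃ : VanishesFrom k (fun w => i (ψ₃ w)) := hψ₃.comp i
    refine ⟨max m' k, _, h1.trans (le_max_left _ _), (h2.mono (le_max_left _ _)).add
      (hiψ₃.mono (le_max_right _ _)), ?_, ?_⟩
    · rw [dualDiff_add, dualDiff_of_le ω nabla h2 (le_max_left _ _), h3,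
        dualDiff_of_le ω nabla hiψ₃ (le_max_right _ _), dualDiff_comp ω hori, hψ₃']
      ext v
      simp
    · have e1 := map_mem_ker_smul_top b i hψ₃''
      have e2 := Submodule.smul_mem_smul hk (Submodule.mem_top (R := R) (x := e))
      have := Submodule.sub_mem _ e1 e2
      convert this using 1
      simp only [Pi.add_apply, Pi.single_eq_same, map_sub]
      rw [hv']
      abel
  · intro m ψ hm hψ hd hb
    have hp0 : ∀ v, KaehlerDifferential.D K R (p (ψ v))
        - ∑ u ∈ wordsLE m, p (ψ (u ++ v)) • ω u = 0 := fun v => by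
      have := congrFun (dualDiff_comp ω horp m ψ) v
      rw [hd, dualDiff_trivialConnection, Pi.zero_apply, map_zero] at this
      exact eq_zero_of_tmul_one this
    have h1 : VanishesFrom 1 (fun w => p (ψ w)) :=
      hω.vanishesFrom_one hm hp0 m ((hψ.comp p).mono (Nat.le_succ _))
    -- With only the empty word left, `p (ψ [])` has zero differential, so it is a constant; its
    -- value at `b` is zero.
    have h2 : p (ψ []) = 0 := by
      have h3 := hp0 []
      rw [Finset.sum_eq_zero, sub_zero] at h3
      · obtain ⟨c, hc⟩ := hω.exists_algebraMap _ h3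
        have := mem_ker_of_mem_ker_smul_top b (map_mem_ker_smul_top b p hb)
        rw [← hc, AlgHom.commutes] at this
        have hc0 : c = 0 := this
        rw [← hc, hc0, map_zero]
      · intro u _
        by_cases hu : u = []
        · rw [hu, hω.nil, smul_zero]
        · have : 0 < (u ++ []).length := by simpa using List.length_pos_iff.2 hu
          have hu0 := h1 _ this
          simp only at hu0
          rw [hu0, zero_smul]
    have h3 : ∀ w, i (q (ψ w)) = ψ w := fun w => by
      have : p (ψ w) = 0 := by
        by_cases hw : w = []
        · rw [hw, h2]
        · exact h1 w (List.length_pos_iff.2 hw)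
      obtain ⟨t, ht⟩ := (hex _).1 this
      rw [← ht, hqi]
    have h4 := h.eq_zero m (fun w => q (ψ w)) hm (hψ.comp q) (by
      ext v
      apply hitens
      have := congrFun (dualDiff_comp ω hori m (fun w => q (ψ w))) v
      rw [← this]
      simp only [h3]
      change dualDiff ω nabla m ψ v = _
      rw [hd]
      simp) (map_mem_ker_smul_top b q hb)
    ext w
    rw [← h3 w]
    rw [show q (ψ w) = 0 from congrFun h4 w, map_zero]
    rfl

theorem IsUnipotent.hasUniqueLifts (b : R →ₐ[K] K) (hω : IsCohomologyBasis ω) {V : Type u}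
    [AddCommGroup V] [Module R V] {nabla : Connection K R V} (h : IsUnipotent V nabla) :
    HasUniqueLifts b ω nabla := by
  induction h with
  | zero M nabla =>
    have : Subsingleton (Ω[R⁄K] ⊗[R] M) := by
      refine subsingleton_of_forall_eq 0 fun t => ?_
      induction t using TensorProduct.induction_on with
      | zero => rfl
      | tmul a m => rw [Subsingleton.elim m 0, TensorProduct.tmul_zero]
      | add a b ha hb => rw [ha, hb, add_zero]
    exact ⟨fun n η _ => ⟨1, 0, le_rfl, fun _ _ => rfl, Subsingleton.elim _ _⟩,
      fun v => ⟨1, 0, le_rfl, fun _ _ => rfl, Subsingleton.elim _ _, by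
        rw [Subsingleton.elim (_ - v) 0]; exact Submodule.zero_mem _⟩,
      fun _ _ _ _ _ _ => Subsingleton.elim _ _⟩
  | extension M' M nabla' nabla i p hi hex hp hori horp h ih =>
    exact ih.extension hω hi hex hp hori horp

end Lifting

/-! ### The universal property -/

section Universal

variable {K R : Type u} [CommRing K] [CommRing R] [Algebra K R] {ω : Series (Ω[R⁄K])}
  {V : Type u} [AddCommGroup V] [Module R V]

/-- The Leibniz terms `ds_v ⊗ ψ(v)` cancel, so the failure of horizontality is `R`-linear in `s`.
Regrouping the cuts `w = u v` by the suffix `v` identifies its coefficients with `dualDiff`. -/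
theorem linearCombination_horizontality_defect (ω : Series (Ω[R⁄K])) (nabla : Connection K R V)
    (n : ℕ) {ψ : Word → V} (hψ : VanishesFrom (n + 1) ψ) (s : WordLE n → R) :
    nabla.toFun (Fintype.linearCombination R (fun v : WordLE n => ψ v) s)
      - (Fintype.linearCombination R (fun v : WordLE n => ψ v)).lTensor (Ω[R⁄K])
        ((truncConnection ω n).toFun s)
      = ∑ v : WordLE n, s v • dualDiff ω nabla n ψ v := by
  let S : Word → R := fun w => if h : w.length ≤ n then s ⟨w, h⟩ else 0
  have hS : ∀ v : WordLE n, s v = S v := fun v => by simp only [S, v.2, dif_pos]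
  have h1 : nabla.toFun (Fintype.linearCombination R (fun v : WordLE n => ψ v) s)
      = ∑ v : WordLE n, (KaehlerDifferential.D K R (s v) ⊗ₜ[R] ψ v
        + s v • nabla.toFun (ψ v)) := by
    rw [Fintype.linearCombination_apply, map_sum]
    exact Finset.sum_congr rfl fun v _ => nabla.leibniz _ _
  have h2 : (Fintype.linearCombination R (fun v : WordLE n => ψ v)).lTensor (Ω[R⁄K])
        ((truncConnection ω n).toFun s)
      = ∑ v : WordLE n, (KaehlerDifferential.D K R (s v) ⊗ₜ[R] ψ v
        + ∑ i ∈ Finset.range (v.1.length + 1), (S (v.1.drop i) • ω (v.1.take i)) ⊗ₜ[R]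
          ψ (v.1.take i ++ v.1.drop i)) := by
    change LinearMap.lTensor _ _ (∑ v : WordLE n, _) = _
    rw [map_sum]
    refine Finset.sum_congr rfl fun v _ => ?_
    rw [LinearMap.lTensor_tmul, Fintype.linearCombination_apply_single, one_smul,
      TensorProduct.add_tmul, TensorProduct.sum_tmul]
    congr 1
    refine Finset.sum_congr rfl fun i _ => ?_
    rw [hS, List.take_append_drop]
  have h3 : ∑ v : WordLE n, ∑ i ∈ Finset.range (v.1.length + 1),
      (S (v.1.drop i) • ω (v.1.take i)) ⊗ₜ[R] ψ (v.1.take i ++ v.1.drop i)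
      = ∑ v : WordLE n, S v • ∑ u ∈ wordsLE n, ω u ⊗ₜ[R] ψ (u ++ v) := by
    rw [sum_wordLE n (fun w => ∑ i ∈ Finset.range (w.length + 1),
      (S (w.drop i) • ω (w.take i)) ⊗ₜ[R] ψ (w.take i ++ w.drop i)),
      sum_wordsLE_factor n (fun u v => (S v • ω u) ⊗ₜ[R] ψ (u ++ v)),
      sum_wordLE n (fun v => S v • ∑ u ∈ wordsLE n, ω u ⊗ₜ[R] ψ (u ++ v))]
    · simp only [Finset.smul_sum, TensorProduct.smul_tmul']
    · intro u v huv
      rw [hψ _ huv, TensorProduct.tmul_zero]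
  rw [h1, h2, Finset.sum_add_distrib, Finset.sum_add_distrib, h3, add_sub_add_left_eq_sub,
    ← Finset.sum_sub_distrib]
  refine Finset.sum_congr rfl fun v _ => ?_
  rw [hS, dualDiff, smul_sub]

theorem isHorizontal_linearCombination_iff (nabla : Connection K R V)
    (n : ℕ) {ψ : Word → V} (hψ : VanishesFrom (n + 1) ψ) :
    IsHorizontal (truncConnection ω n) nabla
      (Fintype.linearCombination R (fun v : WordLE n => ψ v)) ↔ dualDiff ω nabla n ψ = 0 := by
  constructor
  · intro h
    ext v
    by_cases hv : v.length ≤ n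
    · have := linearCombination_horizontality_defect ω nabla n hψ (Pi.single ⟨v, hv⟩ 1)
      rw [h, sub_self, Finset.sum_eq_single ⟨v, hv⟩] at this
      · rw [Pi.single_eq_same, one_smul] at this
        exact this.symm
      · intro w _ hw
        rw [Pi.single_eq_of_ne hw, zero_smul]
      · simp
    · exact (hψ.dualDiff ω nabla n) v (by omega)
  · intro h s
    have := linearCombination_horizontality_defect ω nabla n hψ s
    simp only [h, Pi.zero_apply, smul_zero, Finset.sum_const_zero] at this
    exact sub_eq_zero.1 this

/-- A morphism is determined by its values at the words, a horizontal function of bounded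
support. -/
theorem isMorphism_iff (nabla : Connection K R V) (φ : Series R →ₗ[R] V) :
    IsMorphism ω nabla φ ↔ ∃ (n : ℕ) (ψ : Word → V), VanishesFrom (n + 1) ψ ∧
      dualDiff ω nabla (n + 1) ψ = 0 ∧ ∀ s, φ s = ∑ v ∈ wordsLE n, s v • ψ v := by
  have hle : ∀ {n : ℕ} {ψ : Word → V}, VanishesFrom (n + 1) ψ →
      dualDiff ω nabla (n + 1) ψ = dualDiff ω nabla n ψ := by
    intro n ψ hψ
    ext v
    rw [dualDiff, dualDiff, sum_wordsLE_of_le (Nat.le_succ n)]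
    intro w hw
    rw [hψ _ (by rw [List.length_append]; omega), TensorProduct.tmul_zero]
  constructor
  · rintro ⟨n, Ψ, hΨ, rfl⟩
    -- The values of `Ψ` on the basis of words, extended by zero.
    let ψ : Word → V := fun w => if h : w.length ≤ n then Ψ (Pi.single ⟨w, h⟩ 1) else 0
    have hψ : VanishesFrom (n + 1) ψ := fun w hw => dif_neg (by omega)
    have hΨψ : Ψ = Fintype.linearCombination R (fun v : WordLE n => ψ v) := by
      refine LinearMap.pi_ext' fun v => LinearMap.ext_ring ?_
      simp only [LinearMap.comp_apply, LinearMap.single_apply,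
        Fintype.linearCombination_apply_single, one_smul]
      simp only [ψ, v.2, dif_pos]
    refine ⟨n, ψ, hψ, ?_, fun s => ?_⟩
    · rw [hle hψ]
      rw [hΨψ] at hΨ
      exact (isHorizontal_linearCombination_iff nabla n hψ).1 hΨ
    · rw [hΨψ, LinearMap.comp_apply, Fintype.linearCombination_apply]
      exact sum_wordLE n (fun v => s v • ψ v)
  · rintro ⟨n, ψ, hψ, hd, hφ⟩
    refine ⟨n, _, (isHorizontal_linearCombination_iff nabla n hψ).2 (by rw [← hle hψ, hd]), ?_⟩
    ext s
    rw [hφ, LinearMap.comp_apply, Fintype.linearCombination_apply]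
    exact (sum_wordLE n (fun v => s v • ψ v)).symm

theorem sum_one_smul (n : ℕ) (ψ : Word → V) :
    ∑ v ∈ wordsLE n, one R v • ψ v = ψ [] := by
  rw [Finset.sum_eq_single []]
  · rw [one, Pi.single_eq_same, one_smul]
  · intro w _ hw
    rw [one, Pi.single_eq_of_ne hw, zero_smul]
  · intro h
    exact absurd (mem_wordsLE.2 (Nat.zero_le n)) h

theorem IsCohomologyBasis.representsUniversal (b : R →ₐ[K] K) (hω : IsCohomologyBasis ω) :
    RepresentsUniversal b ω := by
  refine ⟨isUnipotent_truncConnection ω hω.nil, fun V _ _ nabla hV v => ?_⟩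
  have hl := hV.hasUniqueLifts b hω
  obtain ⟨v, rfl⟩ := Submodule.Quotient.mk_surjective _ v
  refine existsUnique_of_exists_of_unique ?_ ?_
  · obtain ⟨m, ψ, hm, hψ, hd, hv⟩ := hl.exists_lift v
    obtain ⟨n, rfl⟩ := Nat.exists_eq_add_of_le' hm
    refine ⟨Fintype.linearCombination R (fun v : WordLE n => ψ v) ∘ₗ trunc R n, ?_, ?_⟩
    · refine (isMorphism_iff nabla _).2 ⟨n, ψ, hψ, hd, fun s => ?_⟩
      rw [LinearMap.comp_apply, Fintype.linearCombination_apply]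
      exact sum_wordLE n (fun v => s v • ψ v)
    · have : (Fintype.linearCombination R (fun v : WordLE n => ψ v) ∘ₗ trunc R n) (one R)
          = ψ [] := by
        rw [LinearMap.comp_apply, Fintype.linearCombination_apply]
        exact (sum_wordLE n (fun v => one R v • ψ v)).trans (sum_one_smul n ψ)
      rw [this]
      exact (Submodule.Quotient.eq _).2 hv
  · rintro φ φ' ⟨hφ, hφv⟩ ⟨hφ', hφv'⟩
    obtain ⟨n, ψ, hψ, hd, h⟩ := (isMorphism_iff nabla φ).1 hφ
    obtain ⟨n', ψ', hψ', hd', h'⟩ := (isMorphism_iff nabla φ').1 hφ'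
    have hle : n + 1 ≤ max (n + 1) (n' + 1) := le_max_left _ _
    have hle' : n' + 1 ≤ max (n + 1) (n' + 1) := le_max_right _ _
    -- The two morphisms may factor through different truncations; they are compared at a common
    -- cut-off.
    have h0 := hl.eq_zero (max (n + 1) (n' + 1)) (ψ - ψ') (by omega)
      ((hψ.mono hle).sub (hψ'.mono hle')) (by
        rw [dualDiff_sub, dualDiff_of_le ω nabla hψ hle, dualDiff_of_le ω nabla hψ' hle', hd, hd',
          sub_zero]) (by
        rw [h, sum_one_smul] at hφv
        rw [h', sum_one_smul] at hφv'
        exact (Submodule.Quotient.eq _).1 (hφv.trans hφv'.symm))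
    have h1 : ψ = ψ' := sub_eq_zero.1 h0
    subst h1
    ext s
    rw [h, h', ← sum_wordsLE_of_le (le_max_left n n') _ (fun w hw => by rw [hψ w hw, smul_zero]),
      ← sum_wordsLE_of_le (le_max_right n n') _ (fun w hw => by rw [hψ' w hw, smul_zero])]

end Universal

/-! ### Uniqueness of the universal pointed connection -/

section Isomorphism

variable {K R : Type u} [CommRing K] [CommRing R] [Algebra K R]
  {ω ω' : Series (Ω[R⁄K])} {b : R →ₐ[K] K}

theorem IsHorizontal.comp {M N V : Type u} [AddCommGroup M] [Module R M] [AddCommGroup N]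
    [Module R N] [AddCommGroup V] [Module R V] {nM : Connection K R M} {nN : Connection K R N}
    {nV : Connection K R V} {χ : N →ₗ[R] V} {φ : M →ₗ[R] N} (hχ : IsHorizontal nN nV χ)
    (hφ : IsHorizontal nM nN φ) : IsHorizontal nM nV (χ ∘ₗ φ) := fun m => by
  rw [LinearMap.comp_apply, hχ, hφ, LinearMap.lTensor_comp, LinearMap.comp_apply]

theorem isMorphism_trunc (ω : Series (Ω[R⁄K])) (n : ℕ) :
    IsMorphism ω (truncConnection ω n) (trunc R n) :=
  ⟨n, LinearMap.id, fun m => by rw [LinearMap.lTensor_id]; rfl, rfl⟩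

/-- The projection `O⟨⟨A,B⟩⟩ / I^{n+1} → O⟨⟨A,B⟩⟩ / I^{m+1}` for `m ≤ n`. -/
def restrict (R : Type u) [CommRing R] {m n : ℕ} (h : m ≤ n) :
    (WordLE n → R) →ₗ[R] (WordLE m → R) :=
  LinearMap.funLeft R R fun w => ⟨w.1, w.2.trans h⟩

theorem isHorizontal_restrict (ω : Series (Ω[R⁄K])) {m n : ℕ} (h : m ≤ n) :
    IsHorizontal (truncConnection ω n) (truncConnection ω m) (restrict R h) := by
  intro s
  have hs : ∀ v : WordLE n, restrict R h (Pi.single v 1)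
      = if hv : v.1.length ≤ m then Pi.single ⟨v.1, hv⟩ 1 else 0 := fun v => by
    ext w
    split_ifs with hv
    · simp only [restrict, LinearMap.funLeft_apply, Pi.single_apply, Subtype.ext_iff]
    · simp only [restrict, LinearMap.funLeft_apply, Pi.zero_apply]
      rw [Pi.single_eq_of_ne]
      rintro rfl
      exact hv w.2
  change (∑ v : WordLE m, _) = LinearMap.lTensor _ _ (∑ v : WordLE n, _)
  rw [map_sum]
  simp only [LinearMap.lTensor_tmul, hs]
  let ι : WordLE m ↪ WordLE n := ⟨fun w => ⟨w.1, w.2.trans h⟩, fun v w hvw => by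
    simpa [Subtype.ext_iff] using hvw⟩
  rw [← Finset.sum_subset (Finset.subset_univ (Finset.univ.map ι)), Finset.sum_map]
  · refine Finset.sum_congr rfl fun v _ => ?_
    have : (ι v).1.length ≤ m := v.2
    rw [dif_pos this]
    rfl
  · intro v _ hv
    rw [dif_neg, TensorProduct.tmul_zero]
    intro hv'
    exact hv (Finset.mem_map.2 ⟨⟨v.1, hv'⟩, Finset.mem_univ _, rfl⟩)

/-- Between universal pointed connections there is a pointed morphism. -/
theorem RepresentsUniversal.exists_hom (hω : RepresentsUniversal b ω)
    (hω' : RepresentsUniversal b ω') : ∃ g : Series R →ₗ[R] Series R,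
      (∀ n, IsMorphism ω (truncConnection ω' n) (trunc R n ∘ₗ g)) ∧
      ∀ n, evalFibre b _ (trunc R n (g (one R))) = evalFibre b _ (trunc R n (one R)) := by
  choose φ hφ hφu using fun n => hω.2 _ (truncConnection ω' n) (hω'.1 n)
    (evalFibre b _ (trunc R n (one R)))
  -- Both sides are pointed morphisms to `(d + ω')_m`, so uniqueness makes the `φ n` compatible.
  have hcomp : ∀ {m n : ℕ} (h : m ≤ n), restrict R h ∘ₗ φ n = φ m := by
    intro m n h
    refine hφu m _ ⟨?_, ?_⟩
    · obtain ⟨k, ψ, hψ, hφn⟩ := (hφ n).1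
      exact ⟨k, restrict R h ∘ₗ ψ, (isHorizontal_restrict ω' h).comp hψ, by
        rw [hφn, LinearMap.comp_assoc]⟩
    · have h1 := (Submodule.Quotient.eq _).1 (hφ n).2
      have h2 := map_mem_ker_smul_top b (restrict R h) h1
      rw [map_sub] at h2
      exact (Submodule.Quotient.eq _).2 h2
  -- The limit of the `φ n`: the coefficient at `w` is read off at level `|w|`, the first one where
  -- `w` is visible.
  have hg : ∀ n, trunc R n ∘ₗ (LinearMap.pi fun w : Word =>
      LinearMap.proj (⟨w, le_rfl⟩ : WordLE w.length) ∘ₗ φ w.length) = φ n := by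
    intro n
    ext s w
    have := congrFun (LinearMap.congr_fun (hcomp w.2) s) ⟨w.1, le_rfl⟩
    exact this.symm
  refine ⟨LinearMap.pi fun w : Word =>
      LinearMap.proj (⟨w, le_rfl⟩ : WordLE w.length) ∘ₗ φ w.length, fun n => ?_, fun n => ?_⟩
  · rw [hg]
    exact (hφ n).1
  · rw [← LinearMap.comp_apply, hg]
    exact (hφ n).2

theorem RepresentsUniversal.comp_eq_id (hω : RepresentsUniversal b ω)
    {g g' : Series R →ₗ[R] Series R}
    (hg : ∀ n, IsMorphism ω (truncConnection ω' n) (trunc R n ∘ₗ g))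
    (hgb : ∀ n, evalFibre b _ (trunc R n (g (one R))) = evalFibre b _ (trunc R n (one R)))
    (hg' : ∀ n, IsMorphism ω' (truncConnection ω n) (trunc R n ∘ₗ g'))
    (hgb' : ∀ n, evalFibre b _ (trunc R n (g' (one R))) = evalFibre b _ (trunc R n (one R))) :
    g' ∘ₗ g = LinearMap.id := by
  have key : ∀ n, trunc R n ∘ₗ g' ∘ₗ g = trunc R n := by
    intro n
    obtain ⟨k, ψ, hψ, hk⟩ := hg' n
    refine (hω.2 _ (truncConnection ω n) (hω.1 n)
      (evalFibre b _ (trunc R n (one R)))).unique ⟨?_, ?_⟩ ⟨isMorphism_trunc ω n, rfl⟩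
    · obtain ⟨l, χ, hχ, hl⟩ := hg k
      refine ⟨l, ψ ∘ₗ χ, hψ.comp hχ, ?_⟩
      rw [← LinearMap.comp_assoc, hk, LinearMap.comp_assoc, hl, LinearMap.comp_assoc]
    · rw [← hgb' n]
      have h1 := map_mem_ker_smul_top b ψ ((Submodule.Quotient.eq _).1 (hgb k))
      rw [map_sub] at h1
      refine (Submodule.Quotient.eq _).2 ?_
      have e1 : ∀ s, trunc R n (g' s) = ψ (trunc R k s) := fun s => LinearMap.congr_fun hk s
      rw [LinearMap.comp_apply, LinearMap.comp_apply, e1, e1]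
      exact h1
  ext s w
  exact congrFun (LinearMap.congr_fun (key w.length) s) ⟨w, le_rfl⟩

theorem RepresentsUniversal.pointedIsomorphic (hω : RepresentsUniversal b ω)
    (hω' : RepresentsUniversal b ω') : PointedIsomorphic b ω ω' := by
  obtain ⟨g, hg, hgb⟩ := hω.exists_hom hω'
  obtain ⟨g', hg', hgb'⟩ := hω'.exists_hom hω
  refine ⟨LinearEquiv.ofLinearMap g g' (hω'.comp_eq_id hg' hgb' hg hgb)
    (hω.comp_eq_id hg hgb hg' hgb'), hg, hg', ?_⟩
  ext w
  have h1 := (Submodule.Quotient.eq _).1 (hgb w.length)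
  have h2 := mem_ker_of_mem_ker_smul_top b
    (map_mem_ker_smul_top b (LinearMap.proj (⟨w, le_rfl⟩ : WordLE w.length)) h1)
  rw [map_sub, map_sub, sub_eq_zero] at h2
  have h3 : b (g (one R) w) = b (one R w) := h2
  change b (g (one R) w) = one K w
  rw [h3]
  by_cases hw : w = []
  · subst hw
    simp [one]
  · simp [one, hw]

end Isomorphism

/-! ### The differential on polynomials in `x` -/

section Polynomials

open Polynomial

variable {K : Type u} [Field K] (e₄ e₆ : K)

/-- The polynomial `6 x² - 30 e₄`, half the derivative of the cubic. -/
def halfDeriv : K[X] := 6 * X ^ 2 - C (30 * e₄)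

theorem derivative_cubic : derivative (cubic e₄ e₆) = 2 * halfDeriv e₄ := by
  have h2 : (2 : K[X]) = C 2 := rfl
  have h4 : (4 : K[X]) = C 4 := rfl
  have h6 : (6 : K[X]) = C 6 := rfl
  rw [cubic, halfDeriv, h2, h4, h6]
  simp only [derivative_sub, derivative_C_mul, derivative_X_pow, derivative_X, derivative_C,
    ← C_mul, mul_sub]
  rw [← mul_assoc, ← mul_assoc, ← C_mul, ← C_mul, show (2 : K) * (30 * e₄) = 60 * e₄ by ring]
  simp only [Nat.cast_ofNat, mul_one, sub_zero, Nat.add_one_sub_one]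
  norm_num

/-- The polynomial `s` such that `s(x)` is the derivative of `q(x) y` dual to `α`. -/
def oddDeriv (q : K[X]) : K[X] := derivative q * cubic e₄ e₆ + q * halfDeriv e₄

/-- The top coefficient of `q' · 4x³ + q · 6x²` is `4n + 6` times that of `q`; all other terms have
smaller degree. -/
theorem oddDeriv_coeff {q : K[X]} {n : ℕ} (h : q.natDegree ≤ n) :
    (oddDeriv e₄ e₆ q).coeff (n + 2) = (4 * n + 6) * q.coeff n := by
  have h4 : (4 : K[X]) = C 4 := rfl
  have h6 : (6 : K[X]) = C 6 := rfl
  have e : oddDeriv e₄ e₆ q = C 4 * (derivative q * X ^ 3) - C (60 * e₄) * (derivative q * X)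
      - C (140 * e₆) * derivative q + C 6 * (q * X ^ 2) - C (30 * e₄) * q := by
    rw [oddDeriv, cubic, halfDeriv, h4, h6]
    ring
  have hz : ∀ k, n < k → q.coeff k = 0 := fun k hk => coeff_eq_zero_of_natDegree_lt (by omega)
  rw [e]
  simp only [coeff_add, coeff_sub, coeff_C_mul]
  rw [coeff_mul_X_pow, show n + 2 = n + 1 + 1 from rfl, coeff_mul_X, coeff_derivative,
    coeff_derivative, hz (n + 1 + 1) (by omega), hz (n + 1 + 1 + 1) (by omega)]
  cases n with
  | zero =>
    rw [coeff_mul_X_pow']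
    norm_num
  | succ n =>
    rw [show n + 1 + 1 + 1 = n + 3 from rfl, coeff_mul_X_pow, coeff_derivative]
    push_cast
    ring

variable [CharZero K]

theorem four_mul_add_six_ne_zero (n : ℕ) : (4 * n + 6 : K) ≠ 0 := by
  exact_mod_cast (by omega : 4 * n + 6 ≠ 0)

/-- A nonzero `q` would give a polynomial of degree `deg q + 2`, which is at least 2. -/
theorem eq_zero_of_oddDeriv {q : K[X]} {c₀ c₁ : K}
    (h : oddDeriv e₄ e₆ q = C c₀ + C c₁ * X) : q = 0 := by
  by_contra hq
  have h1 := oddDeriv_coeff e₄ e₆ (le_refl q.natDegree)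
  rw [h, coeff_add, coeff_C_succ, coeff_C_mul, coeff_X_of_ne_one (by omega)] at h1
  have h2 : q.coeff q.natDegree ≠ 0 := leadingCoeff_ne_zero.2 hq
  have := mul_ne_zero (four_mul_add_six_ne_zero (K := K) q.natDegree) h2
  simp_all

theorem exists_eq_oddDeriv_add (n : ℕ) : ∀ q : K[X], q.natDegree ≤ n →
    ∃ (s : K[X]) (c₀ c₁ : K), q = oddDeriv e₄ e₆ s + (C c₀ + C c₁ * X) := by
  induction n using Nat.strong_induction_on with
  | _ n ih =>
    intro q hq
    by_cases hn : n ≤ 1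
    · refine ⟨0, q.coeff 0, q.coeff 1, ?_⟩
      conv_lhs => rw [eq_X_add_C_of_natDegree_le_one (hq.trans hn)]
      simp only [oddDeriv, derivative_zero]
      ring
    · obtain ⟨m, rfl⟩ := Nat.exists_eq_add_of_le' (not_le.1 hn)
      -- Chosen so that `oddDeriv t` cancels the coefficient of `x^(m+2)` in `q`.
      let t : K[X] := C (q.coeff (m + 2) / (4 * m + 6)) * X ^ m
      have ht : ∀ k, m ≤ k → t.natDegree ≤ k := fun k hk => (natDegree_C_mul_X_pow_le _ _).trans hk
      obtain ⟨s, c₀, c₁, hs⟩ := ih (m + 1) (by omega) (q - oddDeriv e₄ e₆ t) (by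
        rw [natDegree_le_iff_coeff_eq_zero]
        intro N hN
        obtain ⟨k, rfl⟩ := Nat.exists_eq_add_of_le' (show 2 ≤ N by omega)
        rw [coeff_sub, oddDeriv_coeff e₄ e₆ (ht k (by omega)), coeff_C_mul_X_pow]
        by_cases hk : k = m
        · subst hk
          rw [if_pos rfl, mul_div_cancel₀ _ (four_mul_add_six_ne_zero k), sub_self]
        · rw [if_neg hk, mul_zero, sub_zero]
          exact coeff_eq_zero_of_natDegree_lt (by omega))
      refine ⟨s + t, c₀, c₁, ?_⟩
      rw [sub_eq_iff_eq_add] at hs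
      rw [hs]
      simp only [oddDeriv, derivative_add]
      ring

theorem exists_derivative_eq (q : K[X]) : ∃ s : K[X], derivative s = q := by
  induction q using Polynomial.induction_on' with
  | add p q hp hq =>
    obtain ⟨s, rfl⟩ := hp
    obtain ⟨t, rfl⟩ := hq
    exact ⟨s + t, derivative_add⟩
  | monomial n a =>
    refine ⟨monomial (n + 1) (a / (n + 1)), ?_⟩
    rw [derivative_monomial]
    congr 1
    push_cast
    rw [div_mul_cancel₀]
    exact_mod_cast n.succ_ne_zero

end Polynomials

/-! ### Functions, forms and de Rham cohomology of the punctured curve -/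

section Curve

open Polynomial

variable {K : Type u} [Field K] (e₄ e₆ : K)

theorem aeval_x (q : K[X]) : aeval (x e₄ e₆) q = AdjoinRoot.of _ q := by
  have := aeval_algHom_apply
    (AdjoinRoot.ofAlgHom K ((X : K[X][X]) ^ 2 - C (cubic e₄ e₆))) (X : K[X]) q
  rw [aeval_X_left_apply] at this
  exact this

theorem aeval_cubic {A : Type u} [CommRing A] [Algebra K A] (a : A) : aeval a (cubic e₄ e₆)
    = 4 * a ^ 3 - algebraMap K A (60 * e₄) * a - algebraMap K A (140 * e₆) := by
  simp only [cubic, map_sub, map_mul, map_pow, map_ofNat, aeval_X, aeval_C]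

theorem aeval_halfDeriv {A : Type u} [CommRing A] [Algebra K A] (a : A) :
    aeval a (halfDeriv e₄) = 6 * a ^ 2 - algebraMap K A (30 * e₄) := by
  simp only [halfDeriv, map_sub, map_mul, map_pow, map_ofNat, aeval_X, aeval_C]

theorem y_mul_y : y e₄ e₆ * y e₄ e₆ = aeval (x e₄ e₆) (cubic e₄ e₆) := by
  rw [← sq, y_sq, aeval_cubic]

theorem monic_curve : ((X : K[X][X]) ^ 2 - C (cubic e₄ e₆)).Monic := monic_X_pow_sub_C _ two_ne_zero

theorem exists_eq_aeval_add (r : CoordRing e₄ e₆) :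
    ∃ q s : K[X], r = aeval (x e₄ e₆) q + aeval (x e₄ e₆) s * y e₄ e₆ := by
  obtain ⟨g, rfl⟩ := AdjoinRoot.mk_surjective r
  have hdeg : (g %ₘ ((X : K[X][X]) ^ 2 - C (cubic e₄ e₆))).natDegree ≤ 1 := by
    have := natDegree_modByMonic_lt g (monic_curve e₄ e₆) (fun h => by
      have := congrArg natDegree h
      rw [natDegree_X_pow_sub_C, natDegree_one] at this
      omega)
    rw [natDegree_X_pow_sub_C] at this
    omega
  have h1 : AdjoinRoot.mk ((X : K[X][X]) ^ 2 - C (cubic e₄ e₆)) g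
      = AdjoinRoot.mk _ (g %ₘ ((X : K[X][X]) ^ 2 - C (cubic e₄ e₆))) := by
    rw [AdjoinRoot.mk_eq_mk]
    exact ⟨_, sub_eq_of_eq_add' (modByMonic_add_div g _).symm⟩
  rw [h1, eq_X_add_C_of_natDegree_le_one hdeg]
  refine ⟨(g %ₘ ((X : K[X][X]) ^ 2 - C (cubic e₄ e₆))).coeff 0,
    (g %ₘ ((X : K[X][X]) ^ 2 - C (cubic e₄ e₆))).coeff 1, ?_⟩
  rw [map_add, map_mul, AdjoinRoot.mk_C, AdjoinRoot.mk_C, AdjoinRoot.mk_X, aeval_x, aeval_x,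
    add_comm]
  rfl

theorem eq_zero_of_aeval_add {q s : K[X]}
    (h : aeval (x e₄ e₆) q + aeval (x e₄ e₆) s * y e₄ e₆ = 0) : q = 0 ∧ s = 0 := by
  have h1 : AdjoinRoot.mk ((X : K[X][X]) ^ 2 - C (cubic e₄ e₆)) (C s * X + C q) = 0 := by
    rw [map_add, map_mul, AdjoinRoot.mk_C, AdjoinRoot.mk_C, AdjoinRoot.mk_X, ← h, aeval_x, aeval_x,
      add_comm]
    rfl
  have h2 : C s * X + C q = 0 := by
    by_contra hne
    refine AdjoinRoot.mk_ne_zero_of_natDegree_lt (monic_curve e₄ e₆) hne ?_ h1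
    rw [natDegree_X_pow_sub_C]
    exact natDegree_linear_le.trans_lt one_lt_two
  have h3 := congrArg (coeff · 0) h2
  have h4 := congrArg (coeff · 1) h2
  simp at h3 h4
  exact ⟨h3, h4⟩

theorem aeval_add_injective {q s q' s' : K[X]}
    (h : aeval (x e₄ e₆) q + aeval (x e₄ e₆) s * y e₄ e₆
      = aeval (x e₄ e₆) q' + aeval (x e₄ e₆) s' * y e₄ e₆) : q = q' ∧ s = s' := by
  have := eq_zero_of_aeval_add e₄ e₆ (q := q - q') (s := s - s') (by
    rw [map_sub, map_sub]
    linear_combination h)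
  exact ⟨sub_eq_zero.1 this.1, sub_eq_zero.1 this.2⟩

/-- Stated for a general target to serve twice: for `d` with `m = α`, and for `∂` with `m = 1`. -/
theorem derivation_aeval_add {M : Type u} [AddCommGroup M] [Module K M]
    [Module (CoordRing e₄ e₆) M]
    (δ : Derivation K (CoordRing e₄ e₆) M) (m : M) (hx : δ (x e₄ e₆) = y e₄ e₆ • m)
    (hy : δ (y e₄ e₆) = aeval (x e₄ e₆) (halfDeriv e₄) • m) (q s : K[X]) :
    δ (aeval (x e₄ e₆) q + aeval (x e₄ e₆) s * y e₄ e₆)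
      = (aeval (x e₄ e₆) (oddDeriv e₄ e₆ s)
        + aeval (x e₄ e₆) (derivative q) * y e₄ e₆) • m := by
  have h : y e₄ e₆ * y e₄ e₆ = _ := y_mul_y e₄ e₆
  rw [map_add, Derivation.leibniz, Derivation.map_aeval, Derivation.map_aeval, hx, hy, oddDeriv,
    map_add, map_mul, map_mul, ← h]
  module

/-- Substitution of `x + y ε` and `y + (6 x² - 30 e₄) ε` for `x` and `y`. -/
def toDualNumber : CoordRing e₄ e₆ →ₐ[K] DualNumber (CoordRing e₄ e₆) :=
  AdjoinRoot.liftAlgHom _ (aeval (TrivSqZeroExt.inl (x e₄ e₆) + TrivSqZeroExt.inr (y e₄ e₆)))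
    (TrivSqZeroExt.inl (y e₄ e₆) + TrivSqZeroExt.inr (aeval (x e₄ e₆) (halfDeriv e₄))) (by
    have hy := y_sq e₄ e₆
    have h2 : algebraMap K (CoordRing e₄ e₆) (60 * e₄)
        = 2 * algebraMap K (CoordRing e₄ e₆) (30 * e₄) := by
      rw [← map_ofNat (algebraMap K (CoordRing e₄ e₆)) 2, ← map_mul]
      congr 1
      ring
    rw [eval₂_sub, eval₂_X_pow, eval₂_C]
    change _ - aeval _ (cubic e₄ e₆) = 0
    rw [aeval_cubic, aeval_halfDeriv]
    set x := x e₄ e₆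
    set y := y e₄ e₆
    rw [h2] at hy
    have hε : ∀ a : CoordRing e₄ e₆, (TrivSqZeroExt.inr a : DualNumber (CoordRing e₄ e₆))
        = TrivSqZeroExt.inl a * DualNumber.eps := fun a => by
      ext <;> simp
    have hyε : ∀ g₂ g₃ : CoordRing e₄ e₆, y ^ 2 = 4 * x ^ 3 - 2 * g₂ * x - g₃ →
        (TrivSqZeroExt.inl y : DualNumber (CoordRing e₄ e₆)) ^ 2 = 4 * TrivSqZeroExt.inl x ^ 3
          - 2 * TrivSqZeroExt.inl g₂ * TrivSqZeroExt.inl x - TrivSqZeroExt.inl g₃ := by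
      intro g₂ g₃ h
      have := congrArg (TrivSqZeroExt.inlHom (CoordRing e₄ e₆) (CoordRing e₄ e₆)) h
      simp only [map_sub, map_mul, map_pow, map_ofNat] at this
      exact this
    replace hyε := hyε _ _ hy
    have h1 : algebraMap K (DualNumber (CoordRing e₄ e₆)) (60 * e₄)
        = 2 * TrivSqZeroExt.inl (algebraMap K (CoordRing e₄ e₆) (30 * e₄)) := by
      change TrivSqZeroExt.inlHom (CoordRing e₄ e₆) (CoordRing e₄ e₆)
        (algebraMap K (CoordRing e₄ e₆) (60 * e₄)) = _
      rw [h2, map_mul, map_ofNat]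
      rfl
    have h3 : algebraMap K (DualNumber (CoordRing e₄ e₆)) (140 * e₆)
        = TrivSqZeroExt.inl (algebraMap K (CoordRing e₄ e₆) (140 * e₆)) := rfl
    have h4 : (TrivSqZeroExt.inl (6 * x ^ 2 - algebraMap K (CoordRing e₄ e₆) (30 * e₄)) :
        DualNumber (CoordRing e₄ e₆)) = 6 * TrivSqZeroExt.inl x ^ 2
        - TrivSqZeroExt.inl (algebraMap K (CoordRing e₄ e₆) (30 * e₄)) := by
      change TrivSqZeroExt.inlHom (CoordRing e₄ e₆) (CoordRing e₄ e₆) _ = _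
      rw [map_sub, map_mul, map_pow, map_ofNat]
      rfl
    have hsq : (DualNumber.eps : DualNumber (CoordRing e₄ e₆)) * DualNumber.eps = 0 :=
      DualNumber.eps_mul_eps
    rw [hε, hε, h1, h3, h4]
    generalize (TrivSqZeroExt.inl x : DualNumber (CoordRing e₄ e₆)) = a at *
    generalize (TrivSqZeroExt.inl y : DualNumber (CoordRing e₄ e₆)) = c at *
    generalize (TrivSqZeroExt.inl (algebraMap K (CoordRing e₄ e₆) (30 * e₄)) :
      DualNumber (CoordRing e₄ e₆)) = g at *
    -- The part linear in `ε` cancels identically, as `2 y (6x² - g) = (12x² - 2g) y`; what remains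
    -- is a multiple of `ε²`.
    linear_combination hyε + ((6 * a ^ 2 - g) ^ 2 - 12 * a * c ^ 2
      - 4 * c ^ 3 * DualNumber.eps) * hsq)

theorem toDualNumber_x : toDualNumber e₄ e₆ (x e₄ e₆)
    = TrivSqZeroExt.inl (x e₄ e₆) + TrivSqZeroExt.inr (y e₄ e₆) := by
  rw [x, toDualNumber, AdjoinRoot.liftAlgHom_of, aeval_X]
  rfl

theorem toDualNumber_y : toDualNumber e₄ e₆ (y e₄ e₆)
    = TrivSqZeroExt.inl (y e₄ e₆) + TrivSqZeroExt.inr (aeval (x e₄ e₆) (halfDeriv e₄)) :=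
  AdjoinRoot.liftAlgHom_root _ _ _ _

theorem fst_toDualNumber (r : CoordRing e₄ e₆) : (toDualNumber e₄ e₆ r).fst = r := by
  have h : ∀ q : K[X], (toDualNumber e₄ e₆ (aeval (x e₄ e₆) q)).fst = aeval (x e₄ e₆) q := by
    intro q
    have := aeval_algHom_apply ((TrivSqZeroExt.fstHom K (CoordRing e₄ e₆) (CoordRing e₄ e₆)).comp
      (toDualNumber e₄ e₆)) (x e₄ e₆) q
    rw [AlgHom.comp_apply, toDualNumber_x] at this
    simp only [TrivSqZeroExt.fstHom_apply, AlgHom.comp_apply, TrivSqZeroExt.fst_add,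
      TrivSqZeroExt.fst_inl, TrivSqZeroExt.fst_inr, add_zero] at this
    exact this.symm
  obtain ⟨q, s, rfl⟩ := exists_eq_aeval_add e₄ e₆ r
  rw [map_add, map_mul, TrivSqZeroExt.fst_add, TrivSqZeroExt.fst_mul, h, h, toDualNumber_y]
  simp

/-- The derivation of `O_X` dual to `α`. -/
def curveDerivation : Derivation K (CoordRing e₄ e₆) (CoordRing e₄ e₆) :=
  Derivation.mk' ((TrivSqZeroExt.sndHom (CoordRing e₄ e₆) (CoordRing e₄ e₆)).restrictScalars K ∘ₗ
    (toDualNumber e₄ e₆).toLinearMap) fun r s => by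
    simp [TrivSqZeroExt.snd_mul, fst_toDualNumber, mul_comm]

theorem curveDerivation_x : curveDerivation e₄ e₆ (x e₄ e₆) = y e₄ e₆ := by
  change (toDualNumber e₄ e₆ (x e₄ e₆)).snd = _
  simp [toDualNumber_x]

theorem curveDerivation_y :
    curveDerivation e₄ e₆ (y e₄ e₆) = aeval (x e₄ e₆) (halfDeriv e₄) := by
  change (toDualNumber e₄ e₆ (y e₄ e₆)).snd = _
  simp [toDualNumber_y]

theorem two_mul_y_smul_D_y :
    (2 * y e₄ e₆) • KaehlerDifferential.D K (CoordRing e₄ e₆) (y e₄ e₆)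
      = (2 * aeval (x e₄ e₆) (halfDeriv e₄)) •
        KaehlerDifferential.D K (CoordRing e₄ e₆) (x e₄ e₆) := by
  have h := congrArg (KaehlerDifferential.D K (CoordRing e₄ e₆)) (y_mul_y e₄ e₆)
  rw [Derivation.map_aeval, Derivation.leibniz, derivative_cubic, map_mul, map_ofNat] at h
  rw [← h]
  module

/-- Multiplication by `y` sends `q + s y` to `s p + q y`, where the cubic `p` is nonzero. -/
theorem eq_zero_of_y_mul {r : CoordRing e₄ e₆} [CharZero K] (h : y e₄ e₆ * r = 0) : r = 0 := by
  obtain ⟨q, s, rfl⟩ := exists_eq_aeval_add e₄ e₆ r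
  have hy := y_mul_y e₄ e₆
  have := eq_zero_of_aeval_add e₄ e₆ (q := s * cubic e₄ e₆) (s := q) (by
    rw [map_mul, ← hy]
    linear_combination h)
  have hc : cubic e₄ e₆ ≠ 0 := fun h0 => by
    have := congrArg (coeff · 3) h0
    have h4 : (4 : K[X]) = C 4 := rfl
    simp [cubic, h4] at this
  rw [this.2, (mul_eq_zero.1 this.1).resolve_right hc]
  simp

theorem y_smul_D_y [CharZero K] :
    y e₄ e₆ • KaehlerDifferential.D K (CoordRing e₄ e₆) (y e₄ e₆)
      = aeval (x e₄ e₆) (halfDeriv e₄) • KaehlerDifferential.D K (CoordRing e₄ e₆) (x e₄ e₆) := by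
  have ht : algebraMap K (CoordRing e₄ e₆) (2⁻¹) * 2 = 1 := by
    rw [← map_ofNat (algebraMap K (CoordRing e₄ e₆)) 2, ← map_mul,
      inv_mul_cancel₀ (two_ne_zero' K), map_one]
  have h := congrArg (algebraMap K (CoordRing e₄ e₆) (2⁻¹) • ·) (two_mul_y_smul_D_y e₄ e₆)
  simp only [smul_smul, ← mul_assoc, ht, one_mul] at h
  exact h

variable {e₄ e₆} in
theorem D_y [CharZero K] (hE : disc e₄ e₆ ≠ 0) :
    KaehlerDifferential.D K (CoordRing e₄ e₆) (y e₄ e₆)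
      = aeval (x e₄ e₆) (halfDeriv e₄) • alpha e₄ e₆ := by
  have hd := y_smul_D_y e₄ e₆
  have hy := y_sq e₄ e₆
  have h2 : algebraMap K (CoordRing e₄ e₆) (60 * e₄)
      = 2 * algebraMap K (CoordRing e₄ e₆) (30 * e₄) := by
    rw [← map_ofNat (algebraMap K (CoordRing e₄ e₆)) 2, ← map_mul]
    congr 1
    ring
  have hδ : algebraMap K (CoordRing e₄ e₆) (disc e₄ e₆)⁻¹ *
      (algebraMap K (CoordRing e₄ e₆) (60 * e₄) ^ 3
        - 27 * algebraMap K (CoordRing e₄ e₆) (140 * e₆) ^ 2) = 1 := by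
    rw [← map_ofNat (algebraMap K (CoordRing e₄ e₆)) 27, ← map_pow, ← map_pow, ← map_mul,
      ← map_sub, ← map_mul]
    exact (congrArg _ (inv_mul_cancel₀ hE)).trans (map_one _)
  -- With `h = p'/2`, `α = u y dx + 2 v dy` and `h dx = y dy`, the form `h α` equals `(u y² + 2 v h)
  -- dy`; the bracket is `u p + v p' = 1`.
  rw [alpha, smul_add, smul_comm (aeval (x e₄ e₆) (halfDeriv e₄)), ← hd, smul_smul, smul_smul,
    ← add_smul, aeval_halfDeriv]
  refine ((congrArg (· • _) ?_).trans (one_smul _ _)).symm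
  generalize algebraMap K (CoordRing e₄ e₆) (60 * e₄) = g₂ at *
  generalize algebraMap K (CoordRing e₄ e₆) (30 * e₄) = h₂ at *
  generalize algebraMap K (CoordRing e₄ e₆) (140 * e₆) = g₃ at *
  generalize algebraMap K (CoordRing e₄ e₆) (disc e₄ e₆)⁻¹ = δ at *
  subst h2
  linear_combination hδ + (-δ * (18 * (2 * h₂) * x e₄ e₆ - 27 * g₃)) * hy

variable {e₄ e₆} in
theorem D_aeval_add [CharZero K] (hE : disc e₄ e₆ ≠ 0) (q s : K[X]) :
    KaehlerDifferential.D K (CoordRing e₄ e₆) (aeval (x e₄ e₆) q + aeval (x e₄ e₆) s * y e₄ e₆)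
      = (aeval (x e₄ e₆) (oddDeriv e₄ e₆ s) + aeval (x e₄ e₆) (derivative q) * y e₄ e₆) •
        alpha e₄ e₆ :=
  derivation_aeval_add e₄ e₆ _ _ (y_smul_alpha e₄ e₆ hE).symm (D_y hE) q s

variable {e₄ e₆} in
-- The form `α` generates `Ω¹`: the linear map `η ↦ ⟨∂, η⟩ α` fixes every exact form, and exact
-- forms generate `Ω¹`.
theorem curveDerivation_smul_alpha [CharZero K] (hE : disc e₄ e₆ ≠ 0) (η : Ω[CoordRing e₄ e₆⁄K]) :
    (curveDerivation e₄ e₆).liftKaehlerDifferential η • alpha e₄ e₆ = η := by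
  have : LinearMap.toSpanSingleton _ _ (alpha e₄ e₆) ∘ₗ
      (curveDerivation e₄ e₆).liftKaehlerDifferential = LinearMap.id := by
    refine Derivation.liftKaehlerDifferential_unique _ _ (Derivation.ext fun r => ?_)
    change (curveDerivation e₄ e₆).liftKaehlerDifferential
      (KaehlerDifferential.D K (CoordRing e₄ e₆) r) • alpha e₄ e₆
      = KaehlerDifferential.D K (CoordRing e₄ e₆) r
    obtain ⟨q, s, rfl⟩ := exists_eq_aeval_add e₄ e₆ r
    rw [Derivation.liftKaehlerDifferential_comp_D, D_aeval_add hE, derivation_aeval_add e₄ e₆ (curveDerivation e₄ e₆) 1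
      (by rw [curveDerivation_x, smul_eq_mul, mul_one])
      (by rw [curveDerivation_y, smul_eq_mul, mul_one]), smul_eq_mul, mul_one]
  exact LinearMap.congr_fun this η

variable {e₄ e₆} in
-- If `r α = 0` then `r dx = r y α = 0`; contracting with `∂` gives `r y = 0`, and `y` is not a zero
-- divisor.
theorem eq_zero_of_smul_alpha [CharZero K] (hE : disc e₄ e₆ ≠ 0) {r : CoordRing e₄ e₆}
    (h : r • alpha e₄ e₆ = 0) : r = 0 := by
  refine eq_zero_of_y_mul e₄ e₆ ?_
  have := congrArg (curveDerivation e₄ e₆).liftKaehlerDifferential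
    (congrArg (y e₄ e₆ • ·) h)
  simp only [smul_comm (y e₄ e₆) r, y_smul_alpha e₄ e₆ hE, map_smul,
    Derivation.liftKaehlerDifferential_comp_D, curveDerivation_x, smul_zero, map_zero] at this
  rwa [smul_eq_mul, mul_comm] at this

variable {e₄ e₆} in
theorem isCohomologyBasis_of_letters [CharZero K] (hE : disc e₄ e₆ ≠ 0)
    {ω : Series (Ω[CoordRing e₄ e₆⁄K])} (h : ω [] = 0) (hA : ω [0] = alpha e₄ e₆)
    (hB : ω [1] = beta e₄ e₆) : IsCohomologyBasis ω := by
  have hconst : ∀ c₀ c₁ : K, algebraMap K (CoordRing e₄ e₆) c₀ • ω [0]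
      + algebraMap K (CoordRing e₄ e₆) c₁ • ω [1]
      = aeval (x e₄ e₆) (C c₀ + C c₁ * X : K[X]) • alpha e₄ e₆ := fun c₀ c₁ => by
    rw [hA, hB, beta, smul_smul, ← add_smul, map_add, map_mul, aeval_C, aeval_C, aeval_X]
  refine ⟨h, fun r hr => ?_, fun η => ?_, fun c₀ c₁ f hf => ?_⟩
  · obtain ⟨q, s, rfl⟩ := exists_eq_aeval_add e₄ e₆ r
    rw [D_aeval_add hE] at hr
    obtain ⟨hs, hq⟩ := eq_zero_of_aeval_add e₄ e₆ (eq_zero_of_smul_alpha hE hr)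
    have hs0 : s = 0 := eq_zero_of_oddDeriv e₄ e₆ (c₀ := 0) (c₁ := 0) (by simp [hs])
    refine ⟨q.coeff 0, ?_⟩
    rw [hs0, eq_C_of_derivative_eq_zero hq]
    simp
  · obtain ⟨q, s, hqs⟩ := exists_eq_aeval_add e₄ e₆
      ((curveDerivation e₄ e₆).liftKaehlerDifferential η)
    obtain ⟨t, c₀, c₁, ht⟩ := exists_eq_oddDeriv_add e₄ e₆ q.natDegree q le_rfl
    obtain ⟨a, ha⟩ := exists_derivative_eq s
    -- The differential of `a(x)` accounts for the `y`-part `s y`, that of `t(x) y` for `q` up to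
    -- `c₀ + c₁ x`.
    refine ⟨c₀, c₁, aeval (x e₄ e₆) a + aeval (x e₄ e₆) t * y e₄ e₆, ?_⟩
    rw [add_assoc, hconst, D_aeval_add hE, ← add_smul, ha]
    conv_lhs => rw [← curveDerivation_smul_alpha hE η, hqs, ht, map_add]
    congr 1
    ring
  · obtain ⟨q, s, rfl⟩ := exists_eq_aeval_add e₄ e₆ f
    rw [hconst, D_aeval_add hE, ← sub_eq_zero, ← sub_smul] at hf
    have h1 := sub_eq_zero.1 (eq_zero_of_smul_alpha hE hf)
    have h2 := aeval_add_injective e₄ e₆ (q := C c₀ + C c₁ * X) (s := 0)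
      (q' := oddDeriv e₄ e₆ s) (s' := derivative q)
      (by rw [map_zero, zero_mul, add_zero]; exact h1)
    have hs0 := eq_zero_of_oddDeriv e₄ e₆ h2.1.symm
    have h3 := h2.1
    rw [hs0] at h3
    have h4 := congrArg (coeff · 0) h3
    have h5 := congrArg (coeff · 1) h3
    simp [oddDeriv] at h4 h5
    exact ⟨h4, h5⟩

/-- The exponent has no constant term, so only the zeroth term of the exponential reaches degree 0.
-/
theorem p_zero [CharZero K] : p e₄ e₆ 0 = 1 := by
  have h : PowerSeries.constantCoeff (kzbExponent e₄ e₆) = 0 := by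
    rw [← PowerSeries.coeff_zero_eq_constantCoeff_apply, kzbExponent, PowerSeries.coeff_mk]
    simp
  rw [p, PowerSeries.coeff_subst' (PowerSeries.HasSubst.of_constantCoeff_zero' h),
    finsum_eq_single _ 0]
  · simp
  · intro n hn
    rw [PowerSeries.coeff_zero_eq_constantCoeff_apply, map_pow, h, zero_pow hn, smul_zero]

theorem omegaKZB_A [CharZero K] : omegaKZB e₄ e₆ [0] = alpha e₄ e₆ := by
  have h : (adPow (CoordRing e₄ e₆) 0).coeff (FreeMonoid.ofList [0]) = 1 := by
    rw [adPow, Function.iterate_zero, id, MonoidAlgebra.of_apply, MonoidAlgebra.coeff_single]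
    exact Finsupp.single_eq_same
  rw [omegaKZB, Pi.add_apply, Pi.single_eq_of_ne (by decide), zero_add]
  simp only [List.length_singleton, Finset.sum_range_one]
  rw [h, p_zero, one_mul, one_smul]

theorem omegaKZB_B [CharZero K] : omegaKZB e₄ e₆ [1] = beta e₄ e₆ := by
  have h : (adPow (CoordRing e₄ e₆) 0).coeff (FreeMonoid.ofList [1]) = 0 := by
    rw [adPow, Function.iterate_zero, id, MonoidAlgebra.of_apply, MonoidAlgebra.coeff_single]
    exact Finsupp.single_eq_of_ne (show ([1] : Word) ≠ [0] by decide)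
  rw [omegaKZB, Pi.add_apply, Pi.single_eq_same]
  simp only [List.length_singleton, Finset.sum_range_one]
  rw [h, mul_zero, zero_smul, add_zero]

theorem omegaKZB_nil [CharZero K] : omegaKZB e₄ e₆ [] = 0 := by
  rw [omegaKZB, Pi.add_apply, Pi.single_eq_of_ne (by decide)]
  simp

theorem omegaNaive_nil : omegaNaive e₄ e₆ [] = 0 := by
  rw [omegaNaive, Pi.add_apply, Pi.single_eq_of_ne (by decide), Pi.single_eq_of_ne (by decide),
    add_zero]

theorem omegaNaive_A : omegaNaive e₄ e₆ [0] = alpha e₄ e₆ := by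
  rw [omegaNaive, Pi.add_apply, Pi.single_eq_same, Pi.single_eq_of_ne (by decide), add_zero]

theorem omegaNaive_B : omegaNaive e₄ e₆ [1] = beta e₄ e₆ := by
  rw [omegaNaive, Pi.add_apply, Pi.single_eq_same, Pi.single_eq_of_ne (by decide), zero_add]

end Curve

theorem IsCohomologyBasis.neg {K R : Type u} [CommRing K] [CommRing R] [Algebra K R]
    {ω : Series (Ω[R⁄K])} (h : IsCohomologyBasis ω) : IsCohomologyBasis (-ω) := by
  refine ⟨by rw [Pi.neg_apply, h.nil, neg_zero], h.exists_algebraMap, fun η => ?_,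
    fun c₀ c₁ f hf => ?_⟩
  · obtain ⟨c₀, c₁, f, hη⟩ := h.span η
    exact ⟨-c₀, -c₁, f, by simpa using hη⟩
  · have := h.indep (-c₀) (-c₁) f (by rw [← hf]; simp)
    simpa using this

end KZB

end

theorem mainTheorem3 {K : Type u} [Field K] [CharZero K] (e₄ e₆ : K) (hE : KZB.disc e₄ e₆ ≠ 0)
    (b : KZB.CoordRing e₄ e₆ →ₐ[K] K) :
    KZB.RepresentsUniversal b (-KZB.omegaKZB e₄ e₆) ∧
    ∀ r : KZB.Series (Ω[KZB.CoordRing e₄ e₆⁄K]), (∀ w, w.length ≤ 1 → r w = 0) →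
      KZB.PointedIsomorphic b (KZB.omegaNaive e₄ e₆ + r) (-KZB.omegaNaive e₄ e₆) ∧
      KZB.PointedIsomorphic b (-(KZB.omegaNaive e₄ e₆ + r)) (-KZB.omegaNaive e₄ e₆) := by
  have hK := KZB.isCohomologyBasis_of_letters hE (KZB.omegaKZB_nil e₄ e₆) (KZB.omegaKZB_A e₄ e₆)
    (KZB.omegaKZB_B e₄ e₆)
  have hN := KZB.isCohomologyBasis_of_letters hE (KZB.omegaNaive_nil e₄ e₆)
    (KZB.omegaNaive_A e₄ e₆) (KZB.omegaNaive_B e₄ e₆)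
  refine ⟨hK.neg.representsUniversal b, fun r hr => ?_⟩
  -- The perturbation `r` starts in length 2, so the letter coefficients are still `α` and `β`.
  have hR : KZB.IsCohomologyBasis (KZB.omegaNaive e₄ e₆ + r) :=
    KZB.isCohomologyBasis_of_letters hE
      (by rw [Pi.add_apply, KZB.omegaNaive_nil, hr [] (by simp), add_zero])
      (by rw [Pi.add_apply, KZB.omegaNaive_A, hr [0] (by simp), add_zero])
      (by rw [Pi.add_apply, KZB.omegaNaive_B, hr [1] (by simp), add_zero])
  exact ⟨(hR.representsUniversal b).pointedIsomorphic (hN.neg.representsUniversal b),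
    (hR.neg.representsUniversal b).pointedIsomorphic (hN.neg.representsUniversal b)⟩
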